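/- Let $X$ be a Riemann surface (compact of genus $\ge 2$ is the case of interest, but this is not needed), $L\to X$ a holomorphic line bundle and $n\ge 0$. Let $(V,\phi,Q)$ be an $L$-twisted $\mathrm{SO}_{2n+1}$-Higgs bundle: $V$ is a holomorphic vector bundle of rank $2n+1$ with $\det V\cong\mathcal O_X$, $Q:V\otimes V\to\mathcal O_X$ is a holomorphic, symmetric, fibrewise non-degenerate bilinear form, and $\phi:V\to L\otimes V$ is a holomorphic homomorphism with $Q(\phi v,w)+Q(v,\phi w)=0$. Write $\det(\lambda-\phi)=\lambda\,p(\lambda)$ with $p(\lambda)=\lambda^{2n}+a_2\lambda^{2n-2}+\cdots+a_{2n}$, $a_{2i}\in H^0(X,L^{2i})$, and assume that $(V,\phi,Q)$ is generic in the sense that the spectral curve $\{p(\lambda)=0\}\subset\operatorname{Tot}(L)$ is a smooth divisor ($dp\neq 0$ at every zero of $p$). Let $D\subset X$ be the set of zeros of $a_{2n}$, let $V_0\subset V$ be the family of subspaces whose fibre $(V_0)_x$ consists of the values at $x$ of the local holomorphic sections of $V$ annihilated by $\phi$, and let $V_1=V/V_0$ with projection $\operatorname{pr}:V\to V_1$.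 Let $\operatorname{pr}^*:V_1^*\to V^*\cong V$ be the transpose of $\operatorname{pr}$ followed by the identification $V^*\cong V$ given by $Q$, and let $\psi:V_1^*\oplus V_0\to V$, $\psi(a,b)=\operatorname{pr}^*(a)+b$. Then $V_0$ is a holomorphic line subbundle of $V$, $\psi_x$ is an isomorphism for every $x\notin D$, and for every $x\in D$ there is an injective linear map $i_x:(V_0)_x\to(V_1^*)_x$ such that $\operatorname{pr}_x^*\circ i_x$ is the inclusion $(V_0)_x\subset V_x$, with the following property. Let $\mathcal M_X(V_1^*\oplus V_0)$ be the sheaf of meromorphic sections of $V_1^*\oplus V_0$. Then $\psi^{-1}$ induces an injective morphism of sheaves of $\mathcal O_X$-modules $$\Theta:\mathcal O_X(V)\hookrightarrow\mathcal M_X(V_1^*\oplus V_0)$$ (that is, $\psi(\Theta(s))=s$ off a discrete set for every local section $s$), and for every open $U\subseteq X$ the image of $\Theta_U$ is exactly the set of meromorphic sections of $V_1^*\oplus V_0$ over $U$ that are holomorphic on $U\setminus D$ and have at most a simple pole at each $x\in U\cap D$, with residue (with respect to a local coordinate centred at $x$) in $$\Gamma_x=\{(-i_x(w),w)\mid w\in(V_0)_x\}.$$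 -/

import Mathlib

set_option linter.unusedSectionVars false

open scoped Manifold ContDiff TensorProduct Topology
open Bundle TopologicalSpace Filter

namespace HiggsHecke

/-! ### Holomorphic functions and holomorphic sections

Everything is done over a Riemann surface `X`, i.e. a one-dimensional complex manifold modelled on
`ℂ`; `ω`-smoothness over `ℂ` is holomorphy.  Germs of functions and sections are represented by
globally defined functions, of which only the values near the point matter. -/

section Functions

variable {X : Type*} [TopologicalSpace X] [ChartedSpace ℂ X]

/-- The function `f` is holomorphic at (hence near) `x`. -/
def HolFunAt (f : X → ℂ) (x : X) : Prop :=
  ContMDiffAt 𝓘(ℂ, ℂ) 𝓘(ℂ, ℂ) ω f x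

theorem HolFunAt.zero (x : X) : HolFunAt (fun _ : X => (0 : ℂ)) x := contMDiffAt_const

theorem HolFunAt.const (c : ℂ) (x : X) : HolFunAt (fun _ : X => c) x := contMDiffAt_const

theorem HolFunAt.add {f g : X → ℂ} {x : X} (hf : HolFunAt f x) (hg : HolFunAt g x) :
    HolFunAt (fun y => f y + g y) x := ContMDiffAt.add hf hg

theorem HolFunAt.mul {f g : X → ℂ} {x : X} (hf : HolFunAt f x) (hg : HolFunAt g x) :
    HolFunAt (fun y => f y * g y) x := ContMDiffAt.mul hf hg

theorem HolFunAt.congr {f g : X → ℂ} {x : X} (hf : HolFunAt f x) (h : g =ᶠ[𝓝 x] f) :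
    HolFunAt g x := ContMDiffAt.congr_of_eventuallyEq hf h

/-- The preferred local coordinate centred at `x`. -/
noncomputable def localCoord (x : X) (y : X) : ℂ := chartAt ℂ x y - chartAt ℂ x x

open scoped Classical in
/-- Extension by zero of a family defined over the open set `U`. Only its germs at points of `U`
are ever used. -/
noncomputable def extZero {E : X → Type*} [∀ x, Zero (E x)] {U : Opens X}
    (s : ∀ x : U, E x) : ∀ x : X, E x :=
  fun x => if h : x ∈ U then s ⟨x, h⟩ else 0

theorem extZero_of_mem {E : X → Type*} [∀ x, Zero (E x)] {U : Opens X}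
    (s : ∀ x : U, E x) {x : X} (h : x ∈ U) : extZero s x = s ⟨x, h⟩ := by
  simp [extZero, h]

theorem eventually_mem {U : Opens X} (x : U) : ∀ᶠ y in 𝓝 (x : X), y ∈ U :=
  U.isOpen.mem_nhds x.2

theorem eventually_mem' {U : Opens X} (x : U) : ∀ᶠ y in 𝓝[≠] (x : X), y ∈ U :=
  nhdsWithin_le_nhds (eventually_mem x)

/-- Restriction of a family over `U` to a smaller open set `U'`. -/
def restrict {E : X → Type*} {U U' : Opens X} (h : U' ≤ U) (s : ∀ x : U, E x) : ∀ x : U', E x :=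
  fun x => s ⟨x, h x.2⟩

theorem extZero_restrict {E : X → Type*} [∀ x, Zero (E x)] {U U' : Opens X} (h : U' ≤ U)
    (s : ∀ x : U, E x) {x : X} (hx : x ∈ U') : extZero (restrict h s) x = extZero s x := by
  rw [extZero_of_mem _ hx, extZero_of_mem _ (h hx)]; rfl

/-- `𝒪_X(U)`, the ring of holomorphic functions on `U`. -/
noncomputable def holFun (U : Opens X) : Subring (U → ℂ) where
  carrier := {f | ∀ x : U, HolFunAt (extZero (E := fun _ => ℂ) f) x}
  mul_mem' {f g} hf hg x := by
    refine ((hf x).mul (hg x)).congr ?_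
    filter_upwards [eventually_mem x] with y hy
    simp [extZero_of_mem _ hy]
  add_mem' {f g} hf hg x := by
    refine ((hf x).add (hg x)).congr ?_
    filter_upwards [eventually_mem x] with y hy
    simp [extZero_of_mem _ hy]
  one_mem' x := by
    refine (HolFunAt.const 1 (x : X)).congr ?_
    filter_upwards [eventually_mem x] with y hy
    simp [extZero_of_mem _ hy]
  zero_mem' x := by
    refine (HolFunAt.zero (x : X)).congr ?_
    filter_upwards [eventually_mem x] with y hy
    simp [extZero_of_mem _ hy]
  neg_mem' {f} hf x := by
    refine ((HolFunAt.const (-1) (x : X)).mul (hf x)).congr ?_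
    filter_upwards [eventually_mem x] with y hy
    simp [extZero_of_mem _ hy]

/-- Restriction of holomorphic functions. -/
noncomputable def resFun {U U' : Opens X} (h : U' ≤ U) : holFun U →+* holFun U' where
  toFun f := ⟨restrict (E := fun _ => ℂ) h f.1, fun x => by
    refine (f.2 ⟨x, h x.2⟩).congr ?_
    filter_upwards [eventually_mem x] with y hy
    exact extZero_restrict (E := fun _ => ℂ) h f.1 hy⟩
  map_one' := rfl
  map_mul' _ _ := rfl
  map_zero' := rfl
  map_add' _ _ := rfl

end Functions

section Sections

variable {X : Type*} [TopologicalSpace X] [ChartedSpace ℂ X]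
  {F : Type*} [NormedAddCommGroup F] [NormedSpace ℂ F]
  {E : X → Type*} [TopologicalSpace (TotalSpace F E)]
  [∀ x, AddCommGroup (E x)] [∀ x, Module ℂ (E x)] [∀ x, TopologicalSpace (E x)]
  [FiberBundle F E] [VectorBundle ℂ F E]

variable (F) in
/-- The section `s` of the holomorphic vector bundle `E` (with model fibre `F`) is holomorphic at
(hence near) `x`. -/
def HolAt (s : ∀ x, E x) (x : X) : Prop :=
  ContMDiffAt 𝓘(ℂ, ℂ) (𝓘(ℂ, ℂ).prod 𝓘(ℂ, F)) ω (fun y => TotalSpace.mk' F y (s y)) x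


theorem HolAt.zero (x : X) : HolAt F (fun y => (0 : E y)) x :=
  contMDiffAt_zeroSection (IB := 𝓘(ℂ, ℂ)) (F := F) (E := E) ℂ

theorem HolAt.add {s t : ∀ x, E x} {x : X} (hs : HolAt F s x) (ht : HolAt F t x) :
    HolAt F (fun y => s y + t y) x := ContMDiffAt.add_section hs ht

theorem HolAt.smul {f : X → ℂ} {s : ∀ x, E x} {x : X} (hf : HolFunAt f x) (hs : HolAt F s x) :
    HolAt F (fun y => f y • s y) x := ContMDiffAt.smul_section hf hs

theorem HolAt.congr {s t : ∀ x, E x} {x : X} (hs : HolAt F s x) (h : ∀ᶠ y in 𝓝 x, t y = s y) :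
    HolAt F t x :=
  ContMDiffAt.congr_of_eventuallyEq hs (h.mono fun y hy => by simp [hy])

variable (F) in
/-- A section `ξ` of the dual bundle `E^*` is holomorphic at `x`: it takes holomorphic sections of
`E` to holomorphic functions. -/
def HolDualAt (ξ : ∀ x, Module.Dual ℂ (E x)) (x : X) : Prop :=
  ∀ s : ∀ y, E y, HolAt F s x → HolFunAt (fun y => ξ y (s y)) x

variable (F E) in
/-- `𝒪_X(E)(U)`, the `𝒪_X(U)`-module of holomorphic sections of `E` over `U`. -/
noncomputable def holSec (U : Opens X) : Submodule (holFun U) (∀ x : U, E x) where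
  carrier := {s | ∀ x : U, HolAt F (extZero s) x}
  zero_mem' x := by
    refine (HolAt.zero (x : X)).congr ?_
    filter_upwards [eventually_mem x] with y hy
    simp [extZero_of_mem _ hy]
  add_mem' {s t} hs ht x := by
    refine ((hs x).add (ht x)).congr ?_
    filter_upwards [eventually_mem x] with y hy
    simp [extZero_of_mem _ hy]
  smul_mem' f s hs x := by
    refine (HolAt.smul (f.2 x) (hs x)).congr ?_
    filter_upwards [eventually_mem x] with y hy
    rw [extZero_of_mem _ hy, extZero_of_mem _ hy, extZero_of_mem _ hy]
    rfl

/-- Restriction of holomorphic sections. -/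
noncomputable def resHol {U U' : Opens X} (h : U' ≤ U) :
    holSec F E U →ₛₗ[resFun h] holSec F E U' where
  toFun s := ⟨restrict h s.1, fun x => by
    refine HolAt.congr (s.2 ⟨x, h x.2⟩) ?_
    filter_upwards [eventually_mem x] with y hy
    exact extZero_restrict h s.1 hy⟩
  map_add' _ _ := rfl
  map_smul' _ _ := rfl

variable (F) in
/-- The family of subspaces `K x ⊆ E x` is a holomorphic line subbundle of `E`: locally it is
spanned by a nowhere vanishing holomorphic section of `E`. -/
def IsHolLineSubbundle (K : ∀ x, Submodule ℂ (E x)) : Prop :=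
  ∀ x, ∃ s : ∀ y, E y, HolAt F s x ∧ s x ≠ 0 ∧ ∀ᶠ y in 𝓝 x, K y = Submodule.span ℂ {s y}

/-! ### The bundle `(E / K)^* ⊕ K` attached to a subbundle `K`, and its meromorphic sections -/

/-- The fibre at `x` of `(E / K)^* ⊕ K`. -/
abbrev QuotDualSum (K : ∀ x, Submodule ℂ (E x)) (x : X) : Type _ :=
  Module.Dual ℂ (E x ⧸ K x) × K x

variable (F) in
/-- A section `(a, b)` of `(E / K)^* ⊕ K` is holomorphic at `x`: `b` is holomorphic as a section
of `E`, and `a` takes (classes modulo `K` of) holomorphic sections of `E` to holomorphic functions. -/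
def HolSumAt (K : ∀ x, Submodule ℂ (E x)) (t : ∀ x, QuotDualSum K x) (x : X) : Prop :=
  HolDualAt F (fun y => (t y).1 ∘ₗ (K y).mkQ) x ∧ HolAt F (fun y => ((t y).2 : E y)) x

theorem HolSumAt.zero (K : ∀ x, Submodule ℂ (E x)) (x : X) :
    HolSumAt F K (fun _ => 0) x := by
  refine ⟨fun s _ => ?_, ?_⟩
  · simpa using HolFunAt.zero x
  · simpa using HolAt.zero (F := F) (E := E) x

theorem HolSumAt.add {K : ∀ x, Submodule ℂ (E x)} {s t : ∀ x, QuotDualSum K x} {x : X}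
    (hs : HolSumAt F K s x) (ht : HolSumAt F K t x) : HolSumAt F K (fun y => s y + t y) x := by
  refine ⟨fun r hr => ?_, ?_⟩
  · simpa using (hs.1 r hr).add (ht.1 r hr)
  · simpa using hs.2.add ht.2

theorem HolSumAt.smul {K : ∀ x, Submodule ℂ (E x)} {f : X → ℂ} {t : ∀ x, QuotDualSum K x} {x : X}
    (hf : HolFunAt f x) (ht : HolSumAt F K t x) : HolSumAt F K (fun y => f y • t y) x := by
  refine ⟨fun r hr => ?_, ?_⟩
  · simpa using hf.mul (ht.1 r hr)
  · simpa using HolAt.smul hf ht.2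

variable (F) in
/-- A section `t` of `(E / K)^* ⊕ K`, defined on a punctured neighbourhood of `x`, is meromorphic
at `x`: there is a holomorphic function `f`, not vanishing identically near `x`, with `f t`
holomorphic at `x`. -/
def MerSumAt (K : ∀ x, Submodule ℂ (E x)) (t : ∀ x, QuotDualSum K x) (x : X) : Prop :=
  ∃ (f : X → ℂ) (t' : ∀ x, QuotDualSum K x), HolFunAt f x ∧ (∀ᶠ y in 𝓝[≠] x, f y ≠ 0) ∧
    HolSumAt F K t' x ∧ ∀ᶠ y in 𝓝[≠] x, f y • t y = t' y

variable (F) in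
/-- Families over `U` which are meromorphic sections of `(E / K)^* ⊕ K`; the values at the points
of a discrete set are irrelevant, see `Mer`. -/
noncomputable def merSec (K : ∀ x, Submodule ℂ (E x)) (U : Opens X) :
    Submodule (holFun U) (∀ x : U, QuotDualSum K x) where
  carrier := {t | ∀ x : U, MerSumAt F K (extZero t) x}
  zero_mem' x := by
    refine ⟨fun _ => 1, fun _ => 0, HolFunAt.const 1 _, by simp, HolSumAt.zero K _, ?_⟩
    filter_upwards [eventually_mem' x] with y hy
    simp [extZero_of_mem _ hy]
  add_mem' {s t} hs ht x := by
    obtain ⟨f, s', hf, hf0, hs', hfs⟩ := hs x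
    obtain ⟨g, t', hg, hg0, ht', hgt⟩ := ht x
    refine ⟨fun y => f y * g y, fun y => g y • s' y + f y • t' y, hf.mul hg, ?_,
      (HolSumAt.smul hg hs').add (HolSumAt.smul hf ht'), ?_⟩
    · filter_upwards [hf0, hg0] with y h1 h2 using mul_ne_zero h1 h2
    · filter_upwards [eventually_mem' x, hfs, hgt] with y hy h1 h2
      rw [← h1, ← h2, extZero_of_mem _ hy, extZero_of_mem _ hy, extZero_of_mem _ hy, Pi.add_apply,
        smul_add, smul_smul, smul_smul, mul_comm (g y)]
  smul_mem' r t ht x := by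
    obtain ⟨f, t', hf, hf0, ht', hft⟩ := ht x
    refine ⟨f, fun y => extZero (E := fun _ => ℂ) r.1 y • t' y, hf, hf0,
      HolSumAt.smul (r.2 x) ht', ?_⟩
    filter_upwards [eventually_mem' x, hft] with y hy h1
    rw [← h1, extZero_of_mem _ hy, extZero_of_mem _ hy, extZero_of_mem _ hy, smul_comm]
    rfl

variable (F) in
/-- Families over `U` which vanish off a discrete closed subset of `U`. -/
noncomputable def nullSec (K : ∀ x, Submodule ℂ (E x)) (U : Opens X) :
    Submodule (holFun U) (merSec F K U) where
  carrier := {t | ∀ x : U, ∀ᶠ y in 𝓝[≠] (x : X), extZero t.1 y = 0}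
  zero_mem' x := by
    filter_upwards [eventually_mem' x] with y hy
    simp [extZero_of_mem _ hy]
  add_mem' {s t} hs ht x := by
    filter_upwards [eventually_mem' x, hs x, ht x] with y hy h1 h2
    rw [extZero_of_mem _ hy] at h1 h2 ⊢
    have : (s + t).1 ⟨y, hy⟩ = s.1 ⟨y, hy⟩ + t.1 ⟨y, hy⟩ := rfl
    rw [this, h1, h2, add_zero]
  smul_mem' r t ht x := by
    filter_upwards [eventually_mem' x, ht x] with y hy h1
    rw [extZero_of_mem _ hy] at h1 ⊢
    have : (r • t).1 ⟨y, hy⟩ = r.1 ⟨y, hy⟩ • t.1 ⟨y, hy⟩ := rfl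
    rw [this, h1, smul_zero]

variable (F) in
/-- `ℳ_X((E / K)^* ⊕ K)(U)`, the `𝒪_X(U)`-module of meromorphic sections over `U`: two families
define the same meromorphic section when they agree off a discrete closed subset. -/
abbrev Mer (K : ∀ x, Submodule ℂ (E x)) (U : Opens X) : Type _ :=
  merSec F K U ⧸ nullSec F K U

variable (F) in
/-- The meromorphic section over `U` defined by a family. -/
noncomputable def toMer (K : ∀ x, Submodule ℂ (E x)) (U : Opens X) :
    merSec F K U →ₗ[holFun U] Mer F K U := (nullSec F K U).mkQ

variable (F) in
/-- Restriction of families of meromorphic sections. -/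
noncomputable def resMerSec (K : ∀ x, Submodule ℂ (E x)) {U U' : Opens X} (h : U' ≤ U) :
    merSec F K U →ₛₗ[resFun h] merSec F K U' where
  toFun t := ⟨restrict h t.1, fun x => by
    obtain ⟨f, t', hf, hf0, ht', hft⟩ := t.2 ⟨x, h x.2⟩
    refine ⟨f, t', hf, hf0, ht', ?_⟩
    filter_upwards [eventually_mem' x, hft] with y hy h1
    rw [← h1, extZero_restrict h t.1 hy]⟩
  map_add' _ _ := rfl
  map_smul' _ _ := rfl

variable (F) in
/-- Restriction of meromorphic sections. -/
noncomputable def resMer (K : ∀ x, Submodule ℂ (E x)) {U U' : Opens X} (h : U' ≤ U) :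
    Mer F K U →ₛₗ[resFun h] Mer F K U' :=
  (nullSec F K U).liftQ ((toMer F K U').comp (resMerSec F K h)) fun t ht => by
    rw [LinearMap.mem_ker, LinearMap.comp_apply, toMer, Submodule.mkQ_apply,
      Submodule.Quotient.mk_eq_zero]
    intro x
    filter_upwards [eventually_mem' x, ht ⟨x, h x.2⟩] with y hy h1
    exact (extZero_restrict h t.1 hy).trans h1

variable (F) in
/-- The section `t`, defined on a punctured neighbourhood of `x`, extends holomorphically to `x`. -/
def ExtendsHolAt (K : ∀ x, Submodule ℂ (E x)) (t : ∀ x, QuotDualSum K x) (x : X) : Prop :=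
  ∃ t' : ∀ x, QuotDualSum K x, HolSumAt F K t' x ∧ ∀ᶠ y in 𝓝[≠] x, t y = t' y

variable (F) in
/-- The section `t`, defined on a punctured neighbourhood of `x`, has at most a simple pole at `x`,
and its residue at `x` (with respect to the local coordinate `z = localCoord x`) is `r`, i.e. `z t`
extends holomorphically to `x` with the value `r`.  Another coordinate multiplies `r` by a nonzero
scalar. -/
def HasSimplePoleResidue (K : ∀ x, Submodule ℂ (E x)) (t : ∀ x, QuotDualSum K x) (x : X)
    (r : QuotDualSum K x) : Prop :=
  ∃ t' : ∀ x, QuotDualSum K x, HolSumAt F K t' x ∧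
    (∀ᶠ y in 𝓝[≠] x, localCoord x y • t y = t' y) ∧ t' x = r

/-- `Γ_x = {(-i w, w) | w ∈ K_x}`. -/
def Gam (K : ∀ x, Submodule ℂ (E x)) (x : X) (i : K x →ₗ[ℂ] Module.Dual ℂ (E x ⧸ K x)) :
    Set (QuotDualSum K x) := {r | ∃ w : K x, r = (-(i w), w)}

variable (F) in
/-- The meromorphic sections over `U` of `(E / K)^* ⊕ K` that are holomorphic away from `D` and have
at most simple poles at the points `x` of `D`, with residues in `Γ_x`. -/
def heckeSec (K : ∀ x, Submodule ℂ (E x)) (D : Set X)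
    (i : ∀ x, K x →ₗ[ℂ] Module.Dual ℂ (E x ⧸ K x)) (U : Opens X) : Set (Mer F K U) :=
  {m | ∃ t : merSec F K U, toMer F K U t = m ∧
    (∀ x : U, (x : X) ∉ D → ExtendsHolAt F K (extZero t.1) x) ∧
    (∀ x : U, (x : X) ∈ D → ∃ r ∈ Gam K (x : X) (i x),
      HasSimplePoleResidue F K (extZero t.1) x r)}

variable (F E) in
/-- The fibres of a vector bundle with finite-dimensional model fibre are finite-dimensional. -/
theorem finite_fiber [FiniteDimensional ℂ F] (x : X) : FiniteDimensional ℂ (E x) :=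
  LinearEquiv.finiteDimensional ((trivializationAt F E x).continuousLinearEquivAt ℂ x
    (FiberBundle.mem_baseSet_trivializationAt' x)).toLinearEquiv.symm

end Sections

section Higgs

variable {X : Type*} [TopologicalSpace X] [ChartedSpace ℂ X]
  (L : X → Type*) [TopologicalSpace (TotalSpace ℂ L)]
  [∀ x, AddCommGroup (L x)] [∀ x, Module ℂ (L x)] [∀ x, TopologicalSpace (L x)]
  [FiberBundle ℂ L] [VectorBundle ℂ ℂ L]
  (n : ℕ)
  (V : X → Type*) [TopologicalSpace (TotalSpace (Fin (2 * n + 1) → ℂ) V)]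
  [∀ x, AddCommGroup (V x)] [∀ x, Module ℂ (V x)] [∀ x, TopologicalSpace (V x)]
  [FiberBundle (Fin (2 * n + 1) → ℂ) V] [VectorBundle ℂ (Fin (2 * n + 1) → ℂ) V]

variable {L V} in
/-- A section of `L ⊗ V` is holomorphic at `x`: near `x` it is a finite sum of tensors `l ⊗ s` of
holomorphic sections. -/
def HolTensorAt (t : ∀ x, L x ⊗[ℂ] V x) (x : X) : Prop :=
  ∃ (k : ℕ) (l : Fin k → ∀ y, L y) (s : Fin k → ∀ y, V y),
    (∀ j, HolAt ℂ (l j) x) ∧ (∀ j, HolAt (Fin (2 * n + 1) → ℂ) (s j) x) ∧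
    ∀ᶠ y in 𝓝 x, t y = ∑ j, l j y ⊗ₜ[ℂ] s j y

/-- An `L`-twisted `SO_{2n+1}`-Higgs bundle `(V, φ, Q)`, on a vector bundle `V` of rank `2n+1`. -/
structure SOHiggsBundle where
  /-- the Higgs field `φ : V → L ⊗ V` -/
  phi : ∀ x, V x →ₗ[ℂ] L x ⊗[ℂ] V x
  /-- the orthogonal form `Q : V ⊗ V → 𝒪_X` -/
  Q : ∀ x, LinearMap.BilinForm ℂ (V x)
  phi_hol : ∀ (x : X) (s : ∀ y, V y), HolAt (Fin (2 * n + 1) → ℂ) s x →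
    HolTensorAt n (fun y => phi y (s y)) x
  Q_hol : ∀ (x : X) (s t : ∀ y, V y), HolAt (Fin (2 * n + 1) → ℂ) s x →
    HolAt (Fin (2 * n + 1) → ℂ) t x → HolFunAt (fun y => Q y (s y) (t y)) x
  Q_symm : ∀ x v w, Q x v w = Q x w v
  Q_nondegenerate : ∀ x, (Q x).Nondegenerate
  /-- `Q(φ v, w) + Q(v, φ w) = 0` in `L_x` -/
  Q_phi : ∀ x v w,
    TensorProduct.rid ℂ (L x) (LinearMap.lTensor (L x) ((Q x).flip w) (phi x v)) +
      TensorProduct.rid ℂ (L x) (LinearMap.lTensor (L x) (Q x v) (phi x w)) = 0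
  /-- `det V` is trivial: there is a nowhere vanishing holomorphic section of `Λ^{2n+1} V^*` -/
  det_trivial : ∃ vol : ∀ x, V x [⋀^Fin (2 * n + 1)]→ₗ[ℂ] ℂ, (∀ x, vol x ≠ 0) ∧
    ∀ (x : X) (s : Fin (2 * n + 1) → ∀ y, V y),
      (∀ j, HolAt (Fin (2 * n + 1) → ℂ) (s j) x) → HolFunAt (fun y => vol y fun j => s j y) x

namespace SOHiggsBundle

variable {L n V} (H : SOHiggsBundle L n V)

/-- The endomorphism `(ξ ⊗ 1) ∘ φ_x` of `V_x` obtained from `φ_x : V_x → L_x ⊗ V_x` and a linear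
form `ξ` on `L_x`. -/
noncomputable def contract (x : X) (ξ : Module.Dual ℂ (L x)) : Module.End ℂ (V x) :=
  (TensorProduct.lid ℂ (V x)).toLinearMap ∘ₗ LinearMap.rTensor (V x) ξ ∘ₗ H.phi x

/-- The characteristic coefficient `a_j`, i.e. the coefficient of `λ^{2n+1-j}` in `det(λ - φ)`.
A vector of `L_x^j` is the same as a homogeneous polynomial of degree `j` on `L_x^*`;
`H.charCoeff j x ξ` is the value of `a_j(x)` at `ξ`. -/
noncomputable def charCoeff (j : ℕ) (x : X) (ξ : Module.Dual ℂ (L x)) : ℂ :=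
  haveI : FiniteDimensional ℂ (V x) := finite_fiber (Fin (2 * n + 1) → ℂ) V x
  (H.contract x ξ).charpoly.coeff (2 * n + 1 - j)

/-- The function on `Tot(L)` which represents the section
`p(λ) = λ^{2n} + a_2 λ^{2n-2} + ⋯ + a_{2n}` of the pull-back of `L^{2n}` with respect to a section
`ξ` of `L^*`, where `λ` is the tautological section. -/
noncomputable def spectralFun (ξ : ∀ x, Module.Dual ℂ (L x)) (v : TotalSpace ℂ L) : ℂ :=
  ∑ j ∈ Finset.range (n + 1), H.charCoeff (2 * j) v.proj (ξ v.proj) *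
    (ξ v.proj v.2) ^ (2 * (n - j))

/-- The spectral curve `{p(λ) = 0} ⊆ Tot(L)` is a smooth divisor: expressed in any local holomorphic
frame `ξ` of `L^*`, the differential of `p` does not vanish at the zeros of `p`. -/
def SmoothSpectralCurve : Prop :=
  ∀ (x : X) (ξ : ∀ y, Module.Dual ℂ (L y)), HolDualAt ℂ ξ x → ξ x ≠ 0 →
    ∀ l : L x, H.spectralFun ξ ⟨x, l⟩ = 0 →
      mfderiv (𝓘(ℂ, ℂ).prod 𝓘(ℂ, ℂ)) 𝓘(ℂ, ℂ) (H.spectralFun ξ) (⟨x, l⟩ : TotalSpace ℂ L) ≠ 0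

/-- The zero set `D` of the section `a_{2n}` of `L^{2n}`. -/
def D : Set X := {x | ∀ ξ : Module.Dual ℂ (L x), H.charCoeff (2 * n) x ξ = 0}

/-- The fibre at `x` of the subbundle `V_0 ⊆ V` induced by the kernel of the sheaf map
`φ : 𝒪_X(V) → 𝒪_X(L ⊗ V)`: the values at `x` of the local holomorphic sections of `V` that are
annihilated by `φ`. -/
def V0 (x : X) : Submodule ℂ (V x) where
  carrier := {v | ∃ s : ∀ y, V y, HolAt (Fin (2 * n + 1) → ℂ) s x ∧
    (∀ᶠ y in 𝓝 x, H.phi y (s y) = 0) ∧ s x = v}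
  zero_mem' := ⟨fun _ => 0, HolAt.zero x, by simp, rfl⟩
  add_mem' := by
    rintro _ _ ⟨s, hs, hs', rfl⟩ ⟨t, ht, ht', rfl⟩
    refine ⟨fun y => s y + t y, hs.add ht, ?_, rfl⟩
    filter_upwards [hs', ht'] with y h1 h2
    rw [map_add, h1, h2, add_zero]
  smul_mem' := by
    rintro c _ ⟨s, hs, hs', rfl⟩
    refine ⟨fun y => c • s y, HolAt.smul (HolFunAt.const c x) hs, ?_, rfl⟩
    filter_upwards [hs'] with y h1
    rw [map_smul, h1, smul_zero]

/-- `pr^* : V_1^* → V^* ≅ V`, the transpose of `pr : V → V_1 = V / V_0` followed by the inverse of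
`v ↦ Q(v, ·)`. -/
noncomputable def prStar (x : X) : Module.Dual ℂ (V x ⧸ H.V0 x) →ₗ[ℂ] V x :=
  haveI : FiniteDimensional ℂ (V x) := finite_fiber (Fin (2 * n + 1) → ℂ) V x
  ((H.Q x).toDual (H.Q_nondegenerate x)).symm.toLinearMap ∘ₗ (H.V0 x).mkQ.dualMap

/-- `ψ : V_1^* ⊕ V_0 → V`, `(a, b) ↦ pr^* a + b`. -/
noncomputable def psi (x : X) : QuotDualSum H.V0 x →ₗ[ℂ] V x :=
  (H.prStar x).coprod (H.V0 x).subtype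

end SOHiggsBundle

end Higgs

end HiggsHecke

open HiggsHecke

/-!
The proof is local, and rests on one holomorphic section `v` spanning `V_0` near a given point.

*Construction of `v`.* In a local frame of `V`, with `L` trivialized, let `G` be the Gram matrix of
`Q` and `B` the matrix of the form `(v, w) ↦ Q(v, φ w)`. As `B` is skew-symmetric of odd size
`2n + 1`, it is singular, and its adjugate `S` is symmetric, has rank at most one
(`adjugate_mul_adjugate_eq`) and has columns in `ker φ`. Moreover `tr (S G) = det G · a_{2n}`
(`SOHiggsBundle.trace_adjugate_mul_gram`). The key point is that `S` vanishes nowhere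
(`SOHiggsBundle.adjugate_skewMatrix_ne_zero`). Indeed, smoothness of the spectral curve along the
zero section of `L` says that `a_{2n}` has simple zeros (`SOHiggsBundle.deriv_charCoeff_ne_zero`).
If `S` vanished at `x`, choose the frame so that `G` is diagonal at `x`; then the derivative of
`tr (S G)` at `x` involves only the derivatives of the diagonal entries of `S`. Such an entry is the
determinant of a skew-symmetric matrix `M` of even size, which is singular at `x`; then
`adj M = 0` at `x` because the rank of a skew-symmetric matrix is even
(`adjugate_eq_zero_of_skew`), and so the derivative of the determinant vanishes. Hence `a_{2n}`
would have a multiple zero at `x`.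

A column `v` of `S` whose diagonal entry `S_{jj}` is nonzero therefore spans `ker φ = V_0` near `x`,
and rank one gives `Q(v, v) = S_{jj} · det G · a_{2n}`. So `Q(v, v)` is nonzero off `D` and has a
simple zero at each point of `D` (`SOHiggsBundle.exists_spanning_section`).

*Conclusion.* The map `pr^*` identifies `V_1^*` with the orthogonal complement of `V_0`. Off `D`, the
line `V_0` is not isotropic, `V` is the orthogonal sum of `V_0` and its complement, and `ψ⁻¹ s` has the
components `s - c v` and `c v` with `c = Q(s, v) / Q(v, v)`. On `D`, the line `V_0` is isotropic, so
that its inclusion factors through `pr^*`, which gives `i_x`; the function `c` has at most a simple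
pole, and the residue of `ψ⁻¹ s` is `(-i_x w, w)` for a multiple `w` of `v`. Conversely, `ψ_x` vanishes
on `Γ_x`, so `ψ` sends a section with simple poles and residues in `Γ` to one that extends
holomorphically over `D`; the local extensions glue (`exists_holSec_of_local`).
-/

namespace HiggsHecke

/-! ### Adjugates of singular and of skew-symmetric matrices -/

section Matrices

open Matrix

variable {m : Type*} [Fintype m] [DecidableEq m]

/-- The vectors in the kernel of a singular matrix are proportional to the columns of its
adjugate. -/
theorem mul_adjugate_eq_of_mulVec_eq_zero {B : Matrix m m ℂ} (hB : B.det = 0) {v : m → ℂ}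
    (hv : B *ᵥ v = 0) (i k j : m) : v k * B.adjugate i j = v i * B.adjugate k j := by
  -- where `adj(B) i j ≠ 0`, replacing column `i` of `B` by a unit vector gives an invertible matrix, so
  -- that a kernel vector is determined by its `i`-th coordinate
  have key : ∀ (i : m), B.adjugate i j ≠ 0 → ∀ (u : m → ℂ), B *ᵥ u = 0 → u i = 0 → u = 0 := by
    intro i hi u hu hui
    have hdet : (B.updateCol i (Pi.single j 1)).det ≠ 0 := by
      rwa [← cramer_apply, cramer_eq_adjugate_mulVec, mulVec_single_one]
    refine Matrix.eq_zero_of_mulVec_eq_zero hdet ?_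
    rw [← hu]
    ext r
    refine Finset.sum_congr rfl fun c _ => ?_
    by_cases hc : c = i
    · subst hc; simp [hui]
    · simp [updateCol_ne hc]
  have hw : B *ᵥ (B.adjugate *ᵥ Pi.single j 1) = 0 := by
    rw [mulVec_mulVec, mul_adjugate, hB, zero_smul, zero_mulVec]
  have main : ∀ i, B.adjugate i j ≠ 0 → ∀ k, v k * B.adjugate i j = v i * B.adjugate k j := by
    intro i hi k
    have := key i hi (B.adjugate i j • v - v i • (B.adjugate *ᵥ Pi.single j 1))
      (by rw [mulVec_sub, mulVec_smul, mulVec_smul, hv, hw]; simp)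
      (by simp; ring)
    have h2 := congrFun this k
    simp at h2
    linear_combination h2
  by_cases hi : B.adjugate i j = 0
  · by_cases hk : B.adjugate k j = 0
    · rw [hi, hk]; simp
    · rw [main k hk i]
  · exact main i hi k

/-- The adjugate of a singular matrix has rank at most one. -/
theorem adjugate_mul_adjugate_eq {B : Matrix m m ℂ} (hB : B.det = 0) (i j k l : m) :
    B.adjugate k l * B.adjugate i j = B.adjugate i l * B.adjugate k j := by
  have h : B *ᵥ (B.adjugate *ᵥ Pi.single l 1) = 0 := by
    rw [mulVec_mulVec, mul_adjugate, hB, zero_smul, zero_mulVec]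
  simpa [mulVec_single_one] using mul_adjugate_eq_of_mulVec_eq_zero hB h i k j

theorem adjugate_transpose_of_skew {B : Matrix m m ℂ} (hB : Bᵀ = -B) :
    B.adjugateᵀ = (-1 : ℂ) ^ (Fintype.card m - 1) • B.adjugate := by
  rw [adjugate_transpose, hB, ← adjugate_smul, neg_one_smul]

theorem det_eq_zero_of_skew {B : Matrix m m ℂ} (hB : Bᵀ = -B) (hm : Odd (Fintype.card m)) :
    B.det = 0 := by
  have h := det_transpose B
  rw [hB, det_neg, hm.neg_one_pow] at h
  linear_combination (-1 / 2 : ℂ) * h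

/-- The corank of a singular skew-symmetric matrix of even size is at least two. -/
theorem adjugate_eq_zero_of_skew {B : Matrix m m ℂ} (hB : Bᵀ = -B) (hm : Even (Fintype.card m))
    (hdet : B.det = 0) : B.adjugate = 0 := by
  ext i j
  have hodd : Odd (Fintype.card m - 1) := by
    have : 0 < Fintype.card m := Fintype.card_pos_iff.2 ⟨i⟩
    obtain ⟨k, hk⟩ := hm
    exact ⟨k - 1, by omega⟩
  have hs := adjugate_transpose_of_skew hB
  rw [hodd.neg_one_pow, neg_one_smul] at hs
  have hij : ∀ i j, B.adjugate j i = -B.adjugate i j := fun i j => congrFun (congrFun hs i) j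
  have hii : B.adjugate i i = 0 := by linear_combination (1 / 2 : ℂ) * hij i i
  have h := adjugate_mul_adjugate_eq hdet i j j i
  rw [hii, zero_mul, hij i j] at h
  simpa using h

/-- Jacobi's formula for the derivative of a determinant. -/
theorem hasDerivAt_det {M : ℂ → Matrix m m ℂ} {M' : Matrix m m ℂ} {c : ℂ}
    (hM : ∀ i j, HasDerivAt (fun t => M t i j) (M' i j) c) :
    HasDerivAt (fun t => (M t).det) ((M c).adjugate * M').trace c := by
  have h : HasDerivAt (fun t => (M t).det)
      (∑ σ : Equiv.Perm m, ((Equiv.Perm.sign σ : ℤ) : ℂ) *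
        ∑ i, (∏ k ∈ Finset.univ.erase i, M c (σ k) k) * M' (σ i) i) c := by
    simp only [det_apply']
    refine HasDerivAt.fun_sum fun σ _ => HasDerivAt.const_mul _ ?_
    simpa [smul_eq_mul] using
      HasDerivAt.fun_finsetProd (u := Finset.univ) fun i _ => hM (σ i) i
  convert h using 1
  have hcol : ∀ i, ((M c).adjugate * M') i i = ((M c).updateCol i fun r => M' r i).det := by
    intro i
    rw [← cramer_apply, cramer_eq_adjugate_mulVec]
    rfl
  simp only [trace, diag_apply, hcol, det_apply', Finset.mul_sum]
  rw [Finset.sum_comm]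
  refine Finset.sum_congr rfl fun σ _ => Finset.sum_congr rfl fun i _ => ?_
  rw [← Finset.mul_prod_erase _ _ (Finset.mem_univ i), updateCol_self, mul_comm (M' _ _)]
  congr 2
  refine Finset.prod_congr rfl fun k hk => ?_
  rw [updateCol_ne (Finset.ne_of_mem_erase hk)]

theorem charpoly_coeff_one (A : Matrix m m ℂ) (hm : Odd (Fintype.card m)) :
    A.charpoly.coeff 1 = A.adjugate.trace := by
  have h1 : HasDerivAt (fun t => A.charpoly.eval t) (A.charpoly.coeff 1) 0 := by
    have := A.charpoly.hasDerivAt 0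
    rwa [← Polynomial.coeff_zero_eq_eval_zero, Polynomial.coeff_derivative, zero_add,
      Nat.cast_zero, zero_add, mul_one] at this
  have h2 : HasDerivAt (fun t : ℂ => (Matrix.scalar m t - A).det)
      ((Matrix.scalar m (0 : ℂ) - A).adjugate * 1).trace 0 := by
    refine hasDerivAt_det fun i j => ?_
    by_cases hij : i = j
    · subst hij
      simpa using (hasDerivAt_id (0 : ℂ)).sub_const (A i i)
    · simpa [hij] using hasDerivAt_const (0 : ℂ) (-A i j)
  simp only [eval_charpoly] at h1
  have := h1.unique h2
  obtain ⟨k, hk⟩ := hm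
  rw [this, map_zero, zero_sub, mul_one, ← neg_one_smul ℂ A, adjugate_smul, hk]
  simp

end Matrices

/-! ### Calculus of holomorphic functions -/

section HolomorphicFunctions

theorem eventually_nhds_of_punctured {X : Type*} [TopologicalSpace X] {p : X → Prop} {x : X}
    (h : ∀ᶠ y in 𝓝[≠] x, p y)
    (hx : p x) : ∀ᶠ y in 𝓝 x, p y := by
  filter_upwards [eventually_nhdsWithin_iff.1 h] with y hy
  by_cases hyx : y = x
  · exact hyx ▸ hx
  · exact hy hyx

variable {X : Type*} [TopologicalSpace X] [ChartedSpace ℂ X]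

theorem HolFunAt.continuousAt {f : X → ℂ} {x : X} (hf : HolFunAt f x) : ContinuousAt f x :=
  ContMDiffAt.continuousAt hf

theorem HolFunAt.div {f g : X → ℂ} {x : X} (hf : HolFunAt f x) (hg : HolFunAt g x)
    (h0 : g x ≠ 0) : HolFunAt (fun y => f y / g y) x := ContMDiffAt.div₀ hf hg h0

theorem HolFunAt.sum {ι : Type*} (t : Finset ι) {f : ι → X → ℂ} {x : X}
    (hf : ∀ i ∈ t, HolFunAt (f i) x) : HolFunAt (fun y => ∑ i ∈ t, f i y) x :=
  contMDiffAt_finsetSum hf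

theorem HolFunAt.prod {ι : Type*} (t : Finset ι) {f : ι → X → ℂ} {x : X}
    (hf : ∀ i ∈ t, HolFunAt (f i) x) : HolFunAt (fun y => ∏ i ∈ t, f i y) x :=
  contMDiffAt_finsetProd hf

theorem HolFunAt.det {m : Type*} [Fintype m] [DecidableEq m] {M : X → Matrix m m ℂ} {x : X}
    (hM : ∀ i j, HolFunAt (fun y => M y i j) x) : HolFunAt (fun y => (M y).det) x := by
  simp only [Matrix.det_apply']
  exact HolFunAt.sum _ fun σ _ =>
    (HolFunAt.const _ x).mul (HolFunAt.prod _ fun i _ => hM (σ i) i)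

theorem HolFunAt.matrix_mul {m : Type*} [Fintype m] {M N : X → Matrix m m ℂ} {x : X}
    (hM : ∀ i j, HolFunAt (fun y => M y i j) x) (hN : ∀ i j, HolFunAt (fun y => N y i j) x)
    (i j : m) : HolFunAt (fun y => (M y * N y) i j) x := by
  simp only [Matrix.mul_apply]
  exact HolFunAt.sum _ fun k _ => (hM i k).mul (hN k j)

theorem HolFunAt.adjugate {m : Type*} [Fintype m] [DecidableEq m] {M : X → Matrix m m ℂ} {x : X}
    (hM : ∀ i j, HolFunAt (fun y => M y i j) x) (i j : m) :
    HolFunAt (fun y => (M y).adjugate i j) x := by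
  simp only [Matrix.adjugate_apply]
  refine HolFunAt.det fun k l => ?_
  by_cases hk : k = j
  · subst hk
    simpa using HolFunAt.const _ x
  · simpa [Matrix.updateRow_ne hk] using hM k l

theorem HolFunAt.eventually [IsManifold 𝓘(ℂ, ℂ) ω X] {f : X → ℂ} {x : X} (hf : HolFunAt f x) :
    ∀ᶠ y in 𝓝 x, HolFunAt f y :=
  (contMDiffAt_iff_contMDiffAt_nhds (by simp)).1 hf

/-- The function `f` read in the preferred chart at `x`. -/
noncomputable def inChart (f : X → ℂ) (x : X) : ℂ → ℂ := f ∘ (chartAt ℂ x).symm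

theorem inChart_self (f : X → ℂ) (x : X) : inChart f x (chartAt ℂ x x) = f x := by
  simp [inChart]

theorem HolFunAt.analyticAt {f : X → ℂ} {x : X} (hf : HolFunAt f x) :
    AnalyticAt ℂ (inChart f x) (chartAt ℂ x x) := by
  have := (contMDiffAt_iff.1 hf).2
  simp only [extChartAt, mfld_simps] at this
  exact (contDiffWithinAt_univ.1 this).analyticAt

theorem HolFunAt.hasDerivAt {f : X → ℂ} {x : X} (hf : HolFunAt f x) :
    HasDerivAt (inChart f x) (deriv (inChart f x) (chartAt ℂ x x)) (chartAt ℂ x x) :=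
  hf.analyticAt.differentiableAt.hasDerivAt

theorem eventually_inChart {f g : X → ℂ} {x : X} (h : ∀ᶠ y in 𝓝 x, f y = g y) :
    inChart f x =ᶠ[𝓝 (chartAt ℂ x x)] inChart g x := by
  have hc : Tendsto (chartAt ℂ x).symm (𝓝 (chartAt ℂ x x)) (𝓝 x) := by
    simpa [ContinuousAt] using
      (chartAt ℂ x).continuousAt_symm ((chartAt ℂ x).map_source (mem_chart_source ℂ x))
  exact hc.eventually h

theorem holFunAt_chart [IsManifold 𝓘(ℂ, ℂ) ω X] (x : X) : HolFunAt (chartAt ℂ x) x := by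
  simpa [extChartAt] using! contMDiffAt_extChartAt (I := 𝓘(ℂ, ℂ)) (n := ω) (x := x)

theorem holFunAt_localCoord [IsManifold 𝓘(ℂ, ℂ) ω X] (x : X) : HolFunAt (localCoord x) x := by
  refine ((holFunAt_chart x).add (HolFunAt.const (-chartAt ℂ x x) x)).congr ?_
  exact Eventually.of_forall fun y => sub_eq_add_neg _ _

theorem localCoord_self (x : X) : localCoord x x = 0 := sub_self _

theorem eventually_localCoord_ne (x : X) : ∀ᶠ y in 𝓝[≠] x, localCoord x y ≠ 0 := by
  filter_upwards [nhdsWithin_le_nhds ((chartAt ℂ x).open_source.mem_nhds (mem_chart_source ℂ x)),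
    self_mem_nhdsWithin] with y hy hne h0
  exact hne ((chartAt ℂ x).injOn hy (mem_chart_source ℂ x) (sub_eq_zero.1 h0))

instance neBot_punctured_nhds (x : X) : (𝓝[≠] x).NeBot := by
  set φ := chartAt ℂ x
  have hx : x ∈ φ.source := mem_chart_source ℂ x
  have hc : Tendsto φ.symm (𝓝[≠] (φ x)) (𝓝[≠] x) := by
    refine tendsto_nhdsWithin_iff.2 ⟨?_, ?_⟩
    · have : Tendsto φ.symm (𝓝 (φ x)) (𝓝 x) := by
        simpa [ContinuousAt, φ.left_inv hx] using φ.continuousAt_symm (φ.map_source hx)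
      exact this.mono_left nhdsWithin_le_nhds
    · filter_upwards [nhdsWithin_le_nhds (φ.open_target.mem_nhds (φ.map_source hx)),
        self_mem_nhdsWithin] with t ht hne h0
      exact hne (by rw [← φ.right_inv ht, h0]; rfl)
  exact hc.neBot

/-- A holomorphic function vanishing at `x` is divisible by the local coordinate; the value of the
quotient at `x` is the derivative. -/
theorem HolFunAt.exists_eq_localCoord_mul [IsManifold 𝓘(ℂ, ℂ) ω X] {f : X → ℂ} {x : X}
    (hf : HolFunAt f x) (h0 : f x = 0) :
    ∃ g : X → ℂ, HolFunAt g x ∧ g x = deriv (inChart f x) (chartAt ℂ x x) ∧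
      ∀ᶠ y in 𝓝 x, f y = localCoord x y * g y := by
  set c := chartAt ℂ x x with hc
  obtain ⟨p, hp⟩ := hf.analyticAt
  have hd : AnalyticAt ℂ (dslope (inChart f x) c) c := ⟨_, hp.has_fpower_series_dslope_fslope⟩
  refine ⟨fun y => dslope (inChart f x) c (chartAt ℂ x y), ?_, ?_, ?_⟩
  · exact (hd.contDiffAt (n := ω)).contMDiffAt.comp x (holFunAt_chart x)
  · simp [hc]
  · filter_upwards [(chartAt ℂ x).open_source.mem_nhds (mem_chart_source ℂ x)] with y hy
    have := sub_smul_dslope (inChart f x) c (chartAt ℂ x y)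
    rw [smul_eq_mul, hc, inChart_self, h0, sub_zero] at this
    rw [localCoord, ← hc, this]
    simp [inChart, (chartAt ℂ x).left_inv hy]

theorem HolFunAt.hasMFDerivAt_zero {f : X → ℂ} {x : X}
    (hf : HolFunAt f x) (h0 : deriv (inChart f x) (chartAt ℂ x x) = 0) :
    HasMFDerivAt 𝓘(ℂ, ℂ) 𝓘(ℂ, ℂ) f x
      (0 : TangentSpace 𝓘(ℂ, ℂ) x →L[ℂ] TangentSpace 𝓘(ℂ, ℂ) (f x)) := by
  refine ⟨hf.continuousAt, ?_⟩
  have h := hf.hasDerivAt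
  rw [h0] at h
  have h1 := h.hasFDerivAt
  simp only [writtenInExtChartAt, extChartAt, mfld_simps]
  refine (h1.congr_fderiv ?_).hasFDerivWithinAt
  ext
  simp
  rfl

theorem HolFunAt.eq_zero_of_eventually {f : X → ℂ} {x : X} (hf : HolFunAt f x)
    (h : ∀ᶠ y in 𝓝[≠] x, f y = 0) : f x = 0 := by
  have h1 : Tendsto f (𝓝[≠] x) (𝓝 (f x)) := hf.continuousAt.tendsto.mono_left nhdsWithin_le_nhds
  have h2 : Tendsto f (𝓝[≠] x) (𝓝 0) := tendsto_const_nhds.congr' (h.mono fun y hy => hy.symm)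
  exact tendsto_nhds_unique h1 h2

end HolomorphicFunctions

/-! ### Holomorphic sections in local frames -/

section HolomorphicSections

variable {X : Type*} [TopologicalSpace X] [ChartedSpace ℂ X]
  {F : Type*} [NormedAddCommGroup F] [NormedSpace ℂ F]
  {E : X → Type*} [TopologicalSpace (TotalSpace F E)]
  [∀ x, AddCommGroup (E x)] [∀ x, Module ℂ (E x)] [∀ x, TopologicalSpace (E x)]
  [FiberBundle F E] [VectorBundle ℂ F E]

theorem HolAt.sub {s t : ∀ x, E x} {x : X} (hs : HolAt F s x) (ht : HolAt F t x) :
    HolAt F (fun y => s y - t y) x := ContMDiffAt.sub_section hs ht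

theorem HolAt.sum {ι : Type*} (t : Finset ι) {s : ι → ∀ x, E x} {x : X}
    (hs : ∀ i ∈ t, HolAt F (s i) x) : HolAt F (fun y => ∑ i ∈ t, s i y) x :=
  ContMDiffAt.sum_section hs

theorem HolAt.eventually [IsManifold 𝓘(ℂ, ℂ) ω X] [ContMDiffVectorBundle ω F E 𝓘(ℂ, ℂ)]
    {s : ∀ x, E x} {x : X} (hs : HolAt F s x) : ∀ᶠ y in 𝓝 x, HolAt F s y :=
  (contMDiffAt_iff_contMDiffAt_nhds (by simp)).1 hs

variable (F E) in
/-- A holomorphic local frame of `E` near `x`, as a family of bases of the fibres over a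
neighbourhood of `x`: the members of the frame are holomorphic, and so are the coefficients of
holomorphic sections. -/
structure HolFrame (x : X) (ι : Type*) where
  /-- the domain of the frame -/
  dom : Set X
  /-- the members of the frame -/
  sec : ι → ∀ y, E y
  /-- the coefficient functionals -/
  coeff : ι → ∀ y, E y →ₗ[ℂ] ℂ
  /-- the basis of the fibre at `y` given by the frame -/
  basis : ∀ y ∈ dom, Module.Basis ι ℂ (E y)
  mem_dom : ∀ᶠ y in 𝓝 x, y ∈ dom
  basis_apply : ∀ y hy i, basis y hy i = sec i y
  repr_apply : ∀ y hy v i, (basis y hy).repr v i = coeff i y v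
  hol_sec : ∀ i, HolAt F (sec i) x
  hol_coeff : ∀ (s : ∀ y, E y), HolAt F s x → ∀ i, HolFunAt (fun y => coeff i y (s y)) x

/-- Every basis of the fibre at `x` extends to a holomorphic local frame. -/
theorem exists_holFrame [ContMDiffVectorBundle ω F E 𝓘(ℂ, ℂ)] [FiniteDimensional ℂ F] {x : X}
    {ι : Type*} (b : Module.Basis ι ℂ (E x)) :
    ∃ f : HolFrame F E x ι, ∀ i, f.sec i x = b i := by
  have : ContMDiffVectorBundle 1 F E 𝓘(ℂ, ℂ) := ContMDiffVectorBundle.of_le (n := ω) le_top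
  set e := trivializationAt F E x
  have hx : x ∈ e.baseSet := FiberBundle.mem_baseSet_trivializationAt' x
  set b' := b.map (e.linearEquivAt ℂ x hx)
  have hmem : ∀ᶠ y in 𝓝 x, y ∈ e.baseSet := e.open_baseSet.mem_nhds hx
  refine ⟨⟨e.baseSet, e.localFrame b', e.localFrameCoeff 𝓘(ℂ, ℂ) b',
    fun y hy => e.basisAt b' hy, hmem, ?_, ?_, ?_, ?_⟩, ?_⟩
  · intro y hy i
    rw [e.localFrame_apply_of_mem_baseSet b' hy]
  · intro y hy v i
    classical
    have := e.localFrameCoeff_apply_of_mem_baseSet (I := 𝓘(ℂ, ℂ)) b' hy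
      (Function.update (fun _ => 0) y v) i
    simpa using this.symm
  · exact fun i => contMDiffAt_localFrame_of_mem ω e b' i hx
  · exact fun s hs i => contMDiffAt_localFrameCoeff b' hx hs i
  · intro i
    refine (e.localFrame_apply_of_mem_baseSet b' hx).trans ?_
    simpa [Trivialization.basisAt, b'] using e.symm_apply_apply_mk hx (b i)

namespace HolFrame

variable {x : X} {ι : Type*} [Fintype ι] (f : HolFrame F E x ι)

theorem self_mem : x ∈ f.dom := f.mem_dom.self_of_nhds

theorem sum_coeff {y : X} (hy : y ∈ f.dom) (v : E y) : ∑ i, f.coeff i y v • f.sec i y = v := by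
  have := (f.basis y hy).sum_repr v
  simpa only [f.basis_apply, f.repr_apply] using this

theorem coeff_sum {y : X} (hy : y ∈ f.dom) (c : ι → ℂ) (i : ι) :
    f.coeff i y (∑ k, c k • f.sec k y) = c i := by
  simp only [← f.repr_apply y hy, ← f.basis_apply y hy]
  exact congrFun (Module.Basis.repr_sum_self _ c) i

theorem eq_zero {y : X} (hy : y ∈ f.dom) {v : E y} (h : ∀ i, f.coeff i y v = 0) : v = 0 := by
  rw [← f.sum_coeff hy v]
  simp [h]

theorem holAt_sum {c : ι → X → ℂ} (hc : ∀ i, HolFunAt (c i) x) :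
    HolAt F (fun y => ∑ i, c i y • f.sec i y) x :=
  HolAt.sum _ fun i _ => HolAt.smul (hc i) (f.hol_sec i)

theorem holAt_of_coeff {s : ∀ y, E y} (h : ∀ i, HolFunAt (fun y => f.coeff i y (s y)) x) :
    HolAt F s x :=
  (f.holAt_sum h).congr (f.mem_dom.mono fun _ hy => (f.sum_coeff hy _).symm)

end HolFrame

variable [ContMDiffVectorBundle ω F E 𝓘(ℂ, ℂ)] [FiniteDimensional ℂ F]

variable (F E) in
theorem exists_finite_holFrame (x : X) :
    ∃ k : ℕ, Nonempty (HolFrame F E x (Fin k)) := by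
  have := finite_fiber F E x
  obtain ⟨f, -⟩ := exists_holFrame (F := F) (Module.finBasis ℂ (E x))
  exact ⟨_, ⟨f⟩⟩

theorem HolAt.eq_zero_of_eventually {s : ∀ y, E y} {x : X} (hs : HolAt F s x)
    (h : ∀ᶠ y in 𝓝[≠] x, s y = 0) : s x = 0 := by
  obtain ⟨k, ⟨f⟩⟩ := exists_finite_holFrame F E x
  refine f.eq_zero f.self_mem fun i => (f.hol_coeff s hs i).eq_zero_of_eventually ?_
  exact h.mono fun y hy => by rw [hy, map_zero]

theorem HolAt.eq_of_eventually {s t : ∀ y, E y} {x : X} (hs : HolAt F s x) (ht : HolAt F t x)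
    (h : ∀ᶠ y in 𝓝[≠] x, s y = t y) : s x = t x :=
  sub_eq_zero.1 ((hs.sub ht).eq_zero_of_eventually (h.mono fun _ hy => sub_eq_zero.2 hy))

/-- A holomorphic section vanishing at `x` is divisible by the local coordinate. -/
theorem HolAt.exists_eq_localCoord_smul [IsManifold 𝓘(ℂ, ℂ) ω X] {s : ∀ y, E y} {x : X}
    (hs : HolAt F s x) (h0 : s x = 0) :
    ∃ t : ∀ y, E y, HolAt F t x ∧ ∀ᶠ y in 𝓝 x, s y = localCoord x y • t y := by
  obtain ⟨k, ⟨f⟩⟩ := exists_finite_holFrame F E x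
  choose g hg _ hgs using fun i =>
    (f.hol_coeff s hs i).exists_eq_localCoord_mul (by rw [h0, map_zero])
  refine ⟨_, f.holAt_sum hg, ?_⟩
  filter_upwards [f.mem_dom, eventually_all.2 hgs] with y hy h
  rw [← f.sum_coeff hy (s y), Finset.smul_sum]
  exact Finset.sum_congr rfl fun i _ => by rw [h i, mul_smul]

/-- A family of vectors which near every point agrees off the point with a local holomorphic
section agrees off a discrete set with a global one. -/
theorem exists_holSec_of_local [T1Space X] [IsManifold 𝓘(ℂ, ℂ) ω X] {U : Opens X} {u : ∀ y, E y}
    (h : ∀ x : U, ∃ s : ∀ y, E y, HolAt F s x ∧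
      ∀ᶠ y in 𝓝[≠] (x : X), u y = s y) :
    ∃ s : holSec F E U, ∀ x : U, ∀ᶠ y in 𝓝[≠] (x : X),
      u y = extZero s.1 y := by
  choose σ hσ hu using h
  have key : ∀ x : U, ∀ᶠ y in 𝓝[≠] (x : X),
      extZero (E := E) (fun y : U => σ y y) y = σ x y ∧ u y = σ x y := by
    intro x
    have h2 := eventually_nhdsWithin_iff.1 (hu x)
    filter_upwards [eventually_mem' x, nhdsWithin_le_nhds (hσ x).eventually, hu x,
      nhdsWithin_le_nhds (eventually_eventually_nhds.2 h2), self_mem_nhdsWithin]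
      with y hy hhol huy hev hne
    refine ⟨?_, huy⟩
    rw [extZero_of_mem _ hy]
    refine HolAt.eq_of_eventually (hσ ⟨y, hy⟩) hhol ?_
    filter_upwards [hu ⟨y, hy⟩, nhdsWithin_le_nhds hev,
      nhdsWithin_le_nhds (eventually_ne_nhds hne)] with z h3 h4 h5
    exact h3.symm.trans (h4 h5)
  refine ⟨⟨fun y => σ y y, fun x => (hσ x).congr ?_⟩, fun x => ?_⟩
  · refine eventually_nhds_of_punctured ((key x).mono fun y hy => hy.1) ?_
    rw [extZero_of_mem _ x.2]
  · exact (key x).mono fun y hy => hy.2.trans hy.1.symm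

end HolomorphicSections

section Higgs

variable {X : Type*} [TopologicalSpace X] [ChartedSpace ℂ X]
  {L : X → Type*} [TopologicalSpace (TotalSpace ℂ L)]
  [∀ x, AddCommGroup (L x)] [∀ x, Module ℂ (L x)] [∀ x, TopologicalSpace (L x)]
  [FiberBundle ℂ L] [VectorBundle ℂ ℂ L]
  {n : ℕ}
  {V : X → Type*} [TopologicalSpace (TotalSpace (Fin (2 * n + 1) → ℂ) V)]
  [∀ x, AddCommGroup (V x)] [∀ x, Module ℂ (V x)] [∀ x, TopologicalSpace (V x)]
  [FiberBundle (Fin (2 * n + 1) → ℂ) V] [VectorBundle ℂ (Fin (2 * n + 1) → ℂ) V]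

variable (n V) in
theorem finrank_fiber (x : X) : Module.finrank ℂ (V x) = 2 * n + 1 := by
  rw [((trivializationAt (Fin (2 * n + 1) → ℂ) V x).continuousLinearEquivAt ℂ x
    (FiberBundle.mem_baseSet_trivializationAt' x)).toLinearEquiv.finrank_eq, Module.finrank_fin_fun]

namespace SOHiggsBundle

/-! ### The Higgs field and the orthogonal form in a local frame -/

variable (H : SOHiggsBundle L n V)

/-- The endomorphisms obtained from `φ` by contraction are skew-symmetric for `Q`. -/
theorem Q_contract (x : X) (ξ : Module.Dual ℂ (L x)) (v w : V x) :
    H.Q x v (H.contract x ξ w) = -H.Q x w (H.contract x ξ v) := by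
  have aux : ∀ (g : Module.Dual ℂ (V x)) (t : L x ⊗[ℂ] V x),
      g (TensorProduct.lid ℂ (V x) (LinearMap.rTensor (V x) ξ t)) =
        ξ (TensorProduct.rid ℂ (L x) (LinearMap.lTensor (L x) g t)) := by
    intro g t
    induction t using TensorProduct.induction_on with
    | zero => simp
    | tmul l u => simp [mul_comm]
    | add a b ha hb => simp only [map_add, ha, hb]
  have h := congrArg ξ (H.Q_phi x v w)
  rw [map_add, map_zero, ← aux, ← aux] at h
  rw [H.Q_symm x w]
  exact eq_neg_of_add_eq_zero_right h

/-- As `L_x` is a line, contraction of `L_x ⊗ V_x` with a nonzero linear form on `L_x` is injective. -/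
theorem phi_eq_zero_of_contract (x : X) {ξ : Module.Dual ℂ (L x)} (hξ : ξ ≠ 0) {v : V x}
    (h : H.contract x ξ v = 0) : H.phi x v = 0 := by
  have e : L x ≃ₗ[ℂ] ℂ := ((trivializationAt ℂ L x).continuousLinearEquivAt ℂ x
    (FiberBundle.mem_baseSet_trivializationAt' x)).toLinearEquiv
  have hfin : Module.finrank ℂ (L x) = 1 := by rw [e.finrank_eq, Module.finrank_self]
  have hinj : Function.Injective ξ := by
    obtain ⟨l, hl⟩ : ∃ l, ξ l ≠ 0 := by
      by_contra! hc
      exact hξ (LinearMap.ext hc)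
    have hl0 : l ≠ 0 := fun h0 => hl (by rw [h0, map_zero])
    refine (injective_iff_map_eq_zero ξ).2 fun w hw => ?_
    obtain ⟨c, rfl⟩ := (finrank_eq_one_iff_of_nonzero' l hl0).1 hfin w
    rw [map_smul, smul_eq_mul, mul_eq_zero] at hw
    rw [hw.resolve_right hl, zero_smul]
  have h1 : LinearMap.rTensor (V x) ξ (H.phi x v) = 0 := by
    simpa [contract] using h
  have h2 := Module.Flat.rTensor_preserves_injective_linearMap (M := V x) ξ hinj
  exact h2 (h1.trans (map_zero _).symm)

theorem holAt_contract {ξ : ∀ y, Module.Dual ℂ (L y)} {x : X} (hξ : HolDualAt ℂ ξ x)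
    {s : ∀ y, V y} (hs : HolAt (Fin (2 * n + 1) → ℂ) s x) :
    HolAt (Fin (2 * n + 1) → ℂ) (fun y => H.contract y (ξ y) (s y)) x := by
  obtain ⟨k, l, t, hl, ht, h⟩ := H.phi_hol x s hs
  refine (HolAt.sum Finset.univ (s := fun j y => ξ y (l j y) • t j y)
    fun j _ => HolAt.smul (hξ (l j) (hl j)) (ht j)).congr ?_
  filter_upwards [h] with y hy
  simp [contract, hy]

section Frame

variable {x : X} {ι : Type*} (f : HolFrame (Fin (2 * n + 1) → ℂ) V x ι)

/-- The Gram matrix of `Q` in a local frame. -/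
def gram (y : X) : Matrix ι ι ℂ := Matrix.of fun i j => H.Q y (f.sec i y) (f.sec j y)

/-- The matrix of the Higgs field in a local frame of `V`, with `L` trivialized by the section `ξ`
of its dual. -/
noncomputable def higgsMatrix (ξ : ∀ y, Module.Dual ℂ (L y)) (y : X) : Matrix ι ι ℂ :=
  Matrix.of fun i j => f.coeff i y (H.contract y (ξ y) (f.sec j y))

theorem gram_hol (i j : ι) : HolFunAt (fun y => H.gram f y i j) x :=
  H.Q_hol x _ _ (f.hol_sec i) (f.hol_sec j)

theorem higgsMatrix_hol {ξ : ∀ y, Module.Dual ℂ (L y)} (hξ : HolDualAt ℂ ξ x) (i j : ι) :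
    HolFunAt (fun y => H.higgsMatrix f ξ y i j) x :=
  f.hol_coeff _ (H.holAt_contract hξ (f.hol_sec j)) i

variable [Fintype ι] [DecidableEq ι]

theorem det_gram_ne_zero {y : X} (hy : y ∈ f.dom) : (H.gram f y).det ≠ 0 := by
  have h := (LinearMap.BilinForm.nondegenerate_iff_det_ne_zero (f.basis y hy)).1
    (H.Q_nondegenerate y)
  convert h using 2
  ext i j
  simp [gram, LinearMap.BilinForm.toMatrix_apply, f.basis_apply]

theorem higgsMatrix_eq (ξ : ∀ y, Module.Dual ℂ (L y)) {y : X} (hy : y ∈ f.dom) :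
    H.higgsMatrix f ξ y =
      LinearMap.toMatrix (f.basis y hy) (f.basis y hy) (H.contract y (ξ y)) := by
  ext i j
  simp [higgsMatrix, LinearMap.toMatrix_apply, f.basis_apply, f.repr_apply]

/-- The matrix of the skew-symmetric form `(v, w) ↦ Q(v, φ w)`. -/
noncomputable def skewMatrix (ξ : ∀ y, Module.Dual ℂ (L y)) (y : X) : Matrix ι ι ℂ :=
  H.gram f y * H.higgsMatrix f ξ y

theorem skewMatrix_hol {ξ : ∀ y, Module.Dual ℂ (L y)} (hξ : HolDualAt ℂ ξ x) (i j : ι) :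
    HolFunAt (fun y => H.skewMatrix f ξ y i j) x :=
  HolFunAt.matrix_mul (H.gram_hol f) (H.higgsMatrix_hol f hξ) i j

theorem skewMatrix_apply (ξ : ∀ y, Module.Dual ℂ (L y)) {y : X} (hy : y ∈ f.dom) (i j : ι) :
    H.skewMatrix f ξ y i j = H.Q y (f.sec i y) (H.contract y (ξ y) (f.sec j y)) := by
  conv_rhs => rw [← f.sum_coeff hy (H.contract y (ξ y) (f.sec j y)), map_sum]
  simp only [skewMatrix, Matrix.mul_apply, gram, higgsMatrix, Matrix.of_apply, map_smul,
    smul_eq_mul]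
  exact Finset.sum_congr rfl fun k _ => mul_comm _ _

theorem skewMatrix_transpose (ξ : ∀ y, Module.Dual ℂ (L y)) {y : X} (hy : y ∈ f.dom) :
    (H.skewMatrix f ξ y).transpose = -H.skewMatrix f ξ y := by
  ext i j
  rw [Matrix.transpose_apply, Matrix.neg_apply, H.skewMatrix_apply f ξ hy,
    H.skewMatrix_apply f ξ hy, H.Q_contract]

theorem contract_eq_zero_iff (ξ : ∀ y, Module.Dual ℂ (L y)) {y : X} (hy : y ∈ f.dom) (v : V y) :
    H.contract y (ξ y) v = 0 ↔
      (H.skewMatrix f ξ y).mulVec (fun i => f.coeff i y v) = 0 := by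
  have h1 : (H.higgsMatrix f ξ y).mulVec (fun i => f.coeff i y v) =
      fun i => f.coeff i y (H.contract y (ξ y) v) := by
    have := LinearMap.toMatrix_mulVec_repr (f.basis y hy) (f.basis y hy) (H.contract y (ξ y)) v
    rw [← H.higgsMatrix_eq f ξ hy] at this
    simpa only [← funext (f.repr_apply y hy _)] using this
  rw [skewMatrix, ← Matrix.mulVec_mulVec, h1]
  constructor
  · intro h
    ext i
    simp [h, Matrix.mulVec, dotProduct]
  · intro h
    exact f.eq_zero hy fun i => congrFun
      (Matrix.eq_zero_of_mulVec_eq_zero (H.det_gram_ne_zero f hy) h) i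

/-- The coefficient of `λ` in `det(λ - φ)` is the trace of the adjugate, the size being odd. -/
theorem charCoeff_eq_trace (hι : Fintype.card ι = 2 * n + 1) (ξ : ∀ y, Module.Dual ℂ (L y))
    {y : X} (hy : y ∈ f.dom) :
    H.charCoeff (2 * n) y (ξ y) = (H.higgsMatrix f ξ y).adjugate.trace := by
  have : FiniteDimensional ℂ (V y) := finite_fiber (Fin (2 * n + 1) → ℂ) V y
  rw [← charpoly_coeff_one _ (hι ▸ odd_two_mul_add_one n), H.higgsMatrix_eq f ξ hy,
    LinearMap.charpoly_toMatrix, charCoeff, Nat.add_sub_cancel_left]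

/-- The coefficient of `λ` in `det(λ G - B) = det G · det(λ - φ)`, where `B = G φ`. -/
theorem trace_adjugate_mul_gram (hι : Fintype.card ι = 2 * n + 1)
    (ξ : ∀ y, Module.Dual ℂ (L y)) {y : X} (hy : y ∈ f.dom) :
    ((H.skewMatrix f ξ y).adjugate * H.gram f y).trace =
      (H.gram f y).det * H.charCoeff (2 * n) y (ξ y) := by
  rw [skewMatrix, Matrix.adjugate_mul_distrib, Matrix.mul_assoc, Matrix.adjugate_mul,
    Matrix.mul_smul, Matrix.mul_one, Matrix.trace_smul, H.charCoeff_eq_trace f hι ξ hy, smul_eq_mul]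

end Frame

/-- The characteristic coefficients are polynomials in the entries of the matrix of the Higgs
field. -/
theorem charCoeff_hol [ContMDiffVectorBundle ω (Fin (2 * n + 1) → ℂ) V 𝓘(ℂ, ℂ)] {x : X}
    {ξ : ∀ y, Module.Dual ℂ (L y)} (hξ : HolDualAt ℂ ξ x) (j : ℕ) :
    HolFunAt (fun y => H.charCoeff j y (ξ y)) x := by
  obtain ⟨k, ⟨f⟩⟩ := exists_finite_holFrame (Fin (2 * n + 1) → ℂ) V x
  have key : ∀ (p : MvPolynomial (Fin k × Fin k) ℂ),
      HolFunAt (fun y => MvPolynomial.eval (fun k => H.higgsMatrix f ξ y k.1 k.2) p) x := by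
    intro p
    induction p using MvPolynomial.induction_on with
    | C a => simpa using HolFunAt.const a x
    | add p q hp hq => simpa using hp.add hq
    | mul_X p k hp => simpa using hp.mul (H.higgsMatrix_hol f hξ k.1 k.2)
  refine (key ((Matrix.charpoly.univ ℂ (Fin k)).coeff (2 * n + 1 - j))).congr ?_
  filter_upwards [f.mem_dom] with y hy
  have : FiniteDimensional ℂ (V y) := finite_fiber (Fin (2 * n + 1) → ℂ) V y
  rw [charCoeff, ← LinearMap.charpoly_toMatrix _ (f.basis y hy), ← H.higgsMatrix_eq f ξ hy]
  exact (Matrix.charpoly.univ_coeff_eval₂Hom (Fin k) (RingHom.id ℂ)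
    (fun k => H.higgsMatrix f ξ y k.1 k.2) _).symm

/-- A section is holomorphic if its products with all holomorphic sections are. -/
theorem holAt_of_Q [ContMDiffVectorBundle ω (Fin (2 * n + 1) → ℂ) V 𝓘(ℂ, ℂ)] {x : X}
    {u : ∀ y, V y} (hu : ∀ s : ∀ y, V y, HolAt (Fin (2 * n + 1) → ℂ) s x →
      HolFunAt (fun y => H.Q y (u y) (s y)) x) : HolAt (Fin (2 * n + 1) → ℂ) u x := by
  obtain ⟨k, ⟨f⟩⟩ := exists_finite_holFrame (Fin (2 * n + 1) → ℂ) V x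
  refine f.holAt_of_coeff fun i => ?_
  have h : HolFunAt (fun y => (∑ j, H.Q y (u y) (f.sec j y) * (H.gram f y).adjugate j i) /
      (H.gram f y).det) x :=
    (HolFunAt.sum _ fun j _ => (hu _ (f.hol_sec j)).mul (HolFunAt.adjugate (H.gram_hol f) j i)).div
      (HolFunAt.det (H.gram_hol f)) (H.det_gram_ne_zero f f.self_mem)
  refine h.congr ?_
  filter_upwards [f.mem_dom] with y hy
  rw [eq_div_iff (H.det_gram_ne_zero f hy)]
  have h1 : (fun j => H.Q y (u y) (f.sec j y)) =
      Matrix.vecMul (fun k => f.coeff k y (u y)) (H.gram f y) := by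
    ext j
    conv_lhs => rw [← f.sum_coeff hy (u y), map_sum, LinearMap.sum_apply]
    simp [Matrix.vecMul, dotProduct, gram]
  have h2 : Matrix.vecMul (fun j => H.Q y (u y) (f.sec j y)) (H.gram f y).adjugate =
      (H.gram f y).det • fun k => f.coeff k y (u y) := by
    rw [h1, Matrix.vecMul_vecMul, Matrix.mul_adjugate, Matrix.vecMul_smul, Matrix.vecMul_one]
  rw [mul_comm]
  exact (congrFun h2 i).symm

end SOHiggsBundle

/-! ### The zeros of `a_{2n}` are simple -/

variable (L) in
/-- The local frame of `L^*` near `x` given by the preferred trivialization of `L` at `x`; it is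
zero off the domain of the trivialization. -/
noncomputable def dualFrame (x y : X) : Module.Dual ℂ (L y) :=
  (trivializationAt ℂ L x).linearMapAt ℂ y

theorem dualFrame_apply {x y : X} (hy : y ∈ (trivializationAt ℂ L x).baseSet) (l : L y) :
    dualFrame L x y l = (trivializationAt ℂ L x ⟨y, l⟩).2 :=
  congrFun ((trivializationAt ℂ L x).coe_linearMapAt_of_mem hy) l

theorem eventually_mem_baseSet (x : X) : ∀ᶠ y in 𝓝 x, y ∈ (trivializationAt ℂ L x).baseSet :=
  (trivializationAt ℂ L x).open_baseSet.mem_nhds (FiberBundle.mem_baseSet_trivializationAt' x)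

theorem dualFrame_hol (x : X) : HolDualAt ℂ (dualFrame L x) x := by
  intro s hs
  have h : HolFunAt (fun y => (trivializationAt ℂ L x ⟨y, s y⟩).2) x :=
    (contMDiffAt_section x).1 hs
  exact h.congr ((eventually_mem_baseSet x).mono fun y hy => dualFrame_apply hy _)

theorem dualFrame_ne_zero {x y : X} (hy : y ∈ (trivializationAt ℂ L x).baseSet) :
    dualFrame L x y ≠ 0 := by
  intro h
  have h1 := dualFrame_apply hy ((trivializationAt ℂ L x).symm y 1)
  rw [h, Trivialization.apply_mk_symm _ hy] at h1
  simp at h1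

namespace SOHiggsBundle

variable (H : SOHiggsBundle L n V)

/-- The term of `p(λ)` of degree zero is split off, and a factor `λ²` is taken out of the others. -/
theorem spectralFun_eq (ξ : ∀ x, Module.Dual ℂ (L x)) (v : TotalSpace ℂ L) :
    H.spectralFun ξ v = H.charCoeff (2 * n) v.proj (ξ v.proj) + ξ v.proj v.2 * (ξ v.proj v.2 *
      ∑ j ∈ Finset.range n, H.charCoeff (2 * j) v.proj (ξ v.proj) *
        (ξ v.proj v.2) ^ (2 * (n - j - 1))) := by
  rw [spectralFun, Finset.sum_range_succ, add_comm, Nat.sub_self, mul_zero, pow_zero, mul_one,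
    ← mul_assoc, Finset.mul_sum]
  congr 1
  refine Finset.sum_congr rfl fun j hj => ?_
  have : 2 * (n - j) = 2 * (n - j - 1) + 2 := by
    have := Finset.mem_range.1 hj
    omega
  rw [this]
  ring

variable [ContMDiffVectorBundle ω (Fin (2 * n + 1) → ℂ) V 𝓘(ℂ, ℂ)]

/-- Along the zero section of `L`, the polynomial `p` is `a_{2n}` up to terms of second order in
the fibre coordinate, so smoothness of the spectral curve forces `a_{2n}` to have simple zeros. -/
theorem deriv_charCoeff_ne_zero (hH : H.SmoothSpectralCurve) {x : X} (hx : x ∈ H.D) :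
    deriv (inChart (fun y => H.charCoeff (2 * n) y (dualFrame L x y)) x) (chartAt ℂ x x) ≠ 0 := by
  intro h0
  set ξ := dualFrame L x with hξ
  set v₀ : TotalSpace ℂ L := ⟨x, 0⟩ with hv₀
  have hmem : x ∈ (trivializationAt ℂ L x).baseSet :=
    FiberBundle.mem_baseSet_trivializationAt' x
  have hs0 : H.spectralFun ξ v₀ = 0 := by
    rw [spectralFun_eq]
    have hv : ξ v₀.proj v₀.2 = 0 := map_zero _
    rw [hv, zero_mul, add_zero]
    exact hx (ξ x)
  refine hH x ξ (dualFrame_hol x) (dualFrame_ne_zero hmem) 0 hs0 ?_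
  have hproj : ContMDiffAt (𝓘(ℂ, ℂ).prod 𝓘(ℂ, ℂ)) 𝓘(ℂ, ℂ) ω
      (TotalSpace.proj : TotalSpace ℂ L → X) v₀ := contMDiffAt_proj L
  have ha := ((H.charCoeff_hol (dualFrame_hol x) (2 * n)).hasMFDerivAt_zero h0).comp v₀
    (hproj.mdifferentiableAt (by simp)).hasMFDerivAt
  have hfib : ContMDiffAt (𝓘(ℂ, ℂ).prod 𝓘(ℂ, ℂ)) 𝓘(ℂ, ℂ) ω
      (fun v : TotalSpace ℂ L => ξ v.proj v.2) v₀ := by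
    refine (contMDiffAt_totalSpace.1 (contMDiffAt_id (x := v₀))).2.congr_of_eventuallyEq ?_
    have hc : Tendsto (TotalSpace.proj : TotalSpace ℂ L → X) (𝓝 v₀) (𝓝 x) :=
      hproj.continuousAt
    exact (hc.eventually (eventually_mem_baseSet x)).mono fun v hv => dualFrame_apply hv _
  have hR : ContMDiffAt (𝓘(ℂ, ℂ).prod 𝓘(ℂ, ℂ)) 𝓘(ℂ, ℂ) ω
      (fun v : TotalSpace ℂ L => ∑ j ∈ Finset.range n, H.charCoeff (2 * j) v.proj (ξ v.proj) *
        (ξ v.proj v.2) ^ (2 * (n - j - 1))) v₀ := by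
    refine contMDiffAt_finsetSum fun j _ => ContMDiffAt.mul ?_ (hfib.pow _)
    exact ContMDiffAt.comp v₀ (g := fun y => H.charCoeff (2 * j) y (ξ y))
      (H.charCoeff_hol (dualFrame_hol x) (2 * j)) hproj
  have h2 := (hfib.mdifferentiableAt (by simp)).hasMFDerivAt.mul
    ((hfib.mul hR).mdifferentiableAt (by simp)).hasMFDerivAt
  have h4 := (ha.add h2).congr_of_eventuallyEq
    (Eventually.of_forall fun v => H.spectralFun_eq ξ v)
  refine h4.mfderiv.trans ?_
  -- by the product rule, as both factors of the second summand vanish at `v₀`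
  have hv : ξ v₀.proj v₀.2 = 0 := map_zero _
  refine ContinuousLinearMap.ext fun w => ?_
  change (0 : ℂ) + (ξ v₀.proj v₀.2 * _ + ξ v₀.proj v₀.2 * _ * _) = 0
  rw [hv]
  ring

end SOHiggsBundle

namespace SOHiggsBundle

/-! ### The kernel of the Higgs field -/

variable [ContMDiffVectorBundle ω (Fin (2 * n + 1) → ℂ) V 𝓘(ℂ, ℂ)]
  (H : SOHiggsBundle L n V)

/-- As `L_y` is a line, vanishing of `a_{2n}` at `y` can be tested on a single nonzero linear form on
`L_y`, by homogeneity. -/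
theorem mem_D_iff {x y : X} (hy : y ∈ (trivializationAt ℂ L x).baseSet) :
    y ∈ H.D ↔ H.charCoeff (2 * n) y (dualFrame L x y) = 0 := by
  refine ⟨fun h => h _, fun h ξ => ?_⟩
  have hL : ∀ l : L y, l = dualFrame L x y l • (trivializationAt ℂ L x).symm y 1 := by
    intro l
    rw [dualFrame_apply hy, ← Trivialization.symmₗ_apply (R := ℂ), ← map_smul, smul_eq_mul,
      mul_one, Trivialization.symmₗ_apply]
    · exact ((trivializationAt ℂ L x).symm_apply_apply_mk hy l).symm
    all_goals exact hy
  obtain ⟨c, rfl⟩ : ∃ c : ℂ, ξ = c • dualFrame L x y := by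
    refine ⟨ξ ((trivializationAt ℂ L x).symm y 1), LinearMap.ext fun l => ?_⟩
    conv_lhs => rw [hL l]
    rw [map_smul, LinearMap.smul_apply, smul_eq_mul, smul_eq_mul, mul_comm]
  have : FiniteDimensional ℂ (V y) := finite_fiber (Fin (2 * n + 1) → ℂ) V y
  let b := Module.finBasis ℂ (V y)
  have hcard : Odd (Fintype.card (Fin (Module.finrank ℂ (V y)))) := by
    rw [Fintype.card_fin, finrank_fiber n V]; exact odd_two_mul_add_one n
  have key : ∀ ξ, H.charCoeff (2 * n) y ξ =
      (LinearMap.toMatrix b b (H.contract y ξ)).adjugate.trace := fun ξ => by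
    rw [← charpoly_coeff_one _ hcard, LinearMap.charpoly_toMatrix, charCoeff,
      Nat.add_sub_cancel_left]
  have hc : H.contract y (c • dualFrame L x y) = c • H.contract y (dualFrame L x y) := by
    ext v
    simp [contract, LinearMap.rTensor_smul]
  rw [key] at h ⊢
  rw [hc, map_smul, Matrix.adjugate_smul, Matrix.trace_smul, h, smul_zero]

/-- There is a holomorphic local frame near `x` which is orthogonal at the point `x` itself. -/
theorem exists_orthogonal_holFrame (x : X) :
    ∃ f : HolFrame (Fin (2 * n + 1) → ℂ) V x (Fin (2 * n + 1)),
      ∀ i j, i ≠ j → H.gram f x i j = 0 := by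
  have : FiniteDimensional ℂ (V x) := finite_fiber (Fin (2 * n + 1) → ℂ) V x
  let _ : Invertible (2 : ℂ) := invertibleOfNonzero two_ne_zero
  obtain ⟨b, hb⟩ := LinearMap.BilinForm.exists_orthogonal_basis (B := H.Q x)
    ⟨fun v w => H.Q_symm x v w⟩
  obtain ⟨f, hf⟩ := exists_holFrame (F := Fin (2 * n + 1) → ℂ)
    (b.reindex (finCongr (finrank_fiber n V x)))
  refine ⟨f, fun i j hij => ?_⟩
  simp only [gram, Matrix.of_apply, hf, Module.Basis.reindex_apply]
  exact hb fun h => hij ((finCongr (finrank_fiber n V x)).symm.injective h)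

/-- The derivative of the adjugate at a zero has vanishing diagonal entries: each of these is the
determinant of a skew-symmetric matrix of even size. -/
theorem deriv_adjugate_diag {x : X} (f : HolFrame (Fin (2 * n + 1) → ℂ) V x (Fin (2 * n + 1)))
    (i : Fin (2 * n + 1)) (h0 : (H.skewMatrix f (dualFrame L x) x).adjugate i i = 0) :
    deriv (inChart (fun y => (H.skewMatrix f (dualFrame L x) y).adjugate i i) x)
      (chartAt ℂ x x) = 0 := by
  set B := H.skewMatrix f (dualFrame L x)
  have hadj : ∀ y, (B y).adjugate i i = ((B y).submatrix i.succAbove i.succAbove).det := fun y => by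
    rw [Matrix.adjugate_fin_succ_eq_det_submatrix, ← two_mul, pow_mul, neg_one_sq, one_pow, one_mul]
  have hx : (chartAt ℂ x).symm (chartAt ℂ x x) = x :=
    (chartAt ℂ x).left_inv (mem_chart_source ℂ x)
  have hd := hasDerivAt_det
    (M := fun t => (B ((chartAt ℂ x).symm t)).submatrix i.succAbove i.succAbove)
    (M' := Matrix.of fun k l => deriv (inChart (fun y => B y (i.succAbove k) (i.succAbove l)) x)
      (chartAt ℂ x x)) (c := chartAt ℂ x x)
    fun k l => (H.skewMatrix_hol f (dualFrame_hol x) (i.succAbove k) (i.succAbove l)).hasDerivAt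
  rw [hx] at hd
  have hz : ((B x).submatrix i.succAbove i.succAbove).adjugate = 0 := by
    refine adjugate_eq_zero_of_skew ?_ (by simp) ?_
    · rw [Matrix.transpose_submatrix, H.skewMatrix_transpose f _ f.self_mem]
      rfl
    · rw [← hadj, h0]
  rw [hz, zero_mul, Matrix.trace_zero] at hd
  have he : inChart (fun y => (B y).adjugate i i) x = fun t =>
      ((B ((chartAt ℂ x).symm t)).submatrix i.succAbove i.succAbove).det :=
    funext fun t => hadj _
  rw [he]
  exact hd.deriv

/-- If the spectral curve is smooth, the kernel of the Higgs field is one-dimensional at every point,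
i.e. the adjugate of the singular matrix `B` vanishes nowhere. -/
theorem adjugate_skewMatrix_ne_zero (hH : H.SmoothSpectralCurve) {x : X}
    (f : HolFrame (Fin (2 * n + 1) → ℂ) V x (Fin (2 * n + 1)))
    (hf : ∀ i j, i ≠ j → H.gram f x i j = 0) :
    (H.skewMatrix f (dualFrame L x) x).adjugate ≠ 0 := by
  intro h0
  set ξ := dualFrame L x
  set c := chartAt ℂ x x
  have htr : ∀ y ∈ f.dom, ∑ i, ∑ k, (H.skewMatrix f ξ y).adjugate i k * H.gram f y k i =
      (H.gram f y).det * H.charCoeff (2 * n) y (ξ y) := fun y hy => by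
    rw [← H.trace_adjugate_mul_gram f (Fintype.card_fin _) ξ hy]
    rfl
  have ha0 : H.charCoeff (2 * n) x (ξ x) = 0 := by
    have := htr x f.self_mem
    rw [h0] at this
    simpa [H.det_gram_ne_zero f f.self_mem] using this
  have hS := fun i k => (HolFunAt.adjugate (H.skewMatrix_hol f (dualFrame_hol x)) i k).hasDerivAt
  have hG := fun i k => (H.gram_hol f i k).hasDerivAt
  have hl := HasDerivAt.fun_sum (u := Finset.univ) fun i _ =>
    HasDerivAt.fun_sum (u := Finset.univ) fun k _ => (hS i k).mul (hG k i)
  have hr := (HolFunAt.det (H.gram_hol f)).hasDerivAt.mul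
    (H.charCoeff_hol (dualFrame_hol x) (2 * n)).hasDerivAt
  have hr' := hr.congr_of_eventuallyEq (eventually_inChart (f.mem_dom.mono htr))
  have h := hr'.unique hl
  simp only [inChart_self] at h
  -- the diagonal terms vanish by `deriv_adjugate_diag`, the others since `G` is diagonal at `x`
  have hzero : ∑ i, ∑ k, (deriv (inChart (fun y => (H.skewMatrix f ξ y).adjugate i k) x) c *
      H.gram f x k i + (H.skewMatrix f ξ x).adjugate i k *
        deriv (inChart (fun y => H.gram f y k i) x) c) = 0 := by
    refine Finset.sum_eq_zero fun i _ => Finset.sum_eq_zero fun k _ => ?_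
    rw [h0, Matrix.zero_apply, zero_mul, add_zero]
    by_cases hik : k = i
    · subst hik
      rw [H.deriv_adjugate_diag f k (by rw [h0, Matrix.zero_apply]), zero_mul]
    · rw [hf k i hik, mul_zero]
  rw [hzero, ha0, mul_zero, zero_add] at h
  have hD : x ∈ H.D := (H.mem_D_iff (FiberBundle.mem_baseSet_trivializationAt' x)).2 ha0
  exact mul_ne_zero (H.det_gram_ne_zero f f.self_mem) (H.deriv_charCoeff_ne_zero hH hD) h

/-- Near every point, `V_0` is spanned by a nowhere vanishing holomorphic section `v`, and `Q(v, v)`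
is nonzero off `D` and has a simple zero at the points of `D`. -/
theorem exists_spanning_section [IsManifold 𝓘(ℂ, ℂ) ω X] (hH : H.SmoothSpectralCurve) (x : X) :
    ∃ v : ∀ y, V y, HolAt (Fin (2 * n + 1) → ℂ) v x ∧ v x ≠ 0 ∧
      (∀ᶠ y in 𝓝 x, H.V0 y = Submodule.span ℂ {v y}) ∧
      (x ∉ H.D → H.Q x (v x) (v x) ≠ 0) ∧
      (x ∈ H.D → ∃ g : X → ℂ, HolFunAt g x ∧ g x ≠ 0 ∧
        ∀ᶠ y in 𝓝 x, H.Q y (v y) (v y) = localCoord x y * g y) := by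
  obtain ⟨f, hf⟩ := H.exists_orthogonal_holFrame x
  have hne := H.adjugate_skewMatrix_ne_zero hH f hf
  set ξ := dualFrame L x with hξ
  set S := fun y => (H.skewMatrix f ξ y).adjugate with hS
  have hdet : ∀ y ∈ f.dom, (H.skewMatrix f ξ y).det = 0 := fun y hy =>
    det_eq_zero_of_skew (H.skewMatrix_transpose f ξ hy) (by simp)
  have hsymm : ∀ y ∈ f.dom, ∀ i k, S y i k = S y k i := fun y hy i k => by
    have := adjugate_transpose_of_skew (H.skewMatrix_transpose f ξ hy)
    rw [Fintype.card_fin, Nat.add_sub_cancel, pow_mul, neg_one_sq, one_pow, one_smul] at this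
    exact congrFun (congrFun this k) i
  have hSS : ∀ y ∈ f.dom, ∀ i j k l, S y k l * S y i j = S y i l * S y k j := fun y hy =>
    adjugate_mul_adjugate_eq (hdet y hy)
  have hShol : ∀ i k, HolFunAt (fun y => S y i k) x := fun i k =>
    HolFunAt.adjugate (H.skewMatrix_hol f (dualFrame_hol x)) i k
  -- a nonzero symmetric matrix of rank one has a nonzero diagonal entry
  obtain ⟨j, hj⟩ : ∃ j, S x j j ≠ 0 := by
    by_contra! hc
    refine hne (Matrix.ext fun i k => ?_)
    have := hSS x f.self_mem k i i k
    rw [hsymm x f.self_mem k i, hc, zero_mul] at this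
    simpa using this
  set v : ∀ y, V y := fun y => ∑ i, S y i j • f.sec i y with hv
  have hvhol : HolAt (Fin (2 * n + 1) → ℂ) v x := f.holAt_sum fun i => hShol i j
  have hvcoeff : ∀ y ∈ f.dom, ∀ i, f.coeff i y (v y) = S y i j := fun y hy i =>
    f.coeff_sum hy (fun i => S y i j) i
  have hker : ∀ᶠ y in 𝓝 x, H.phi y (v y) = 0 := by
    filter_upwards [f.mem_dom, eventually_mem_baseSet (L := L) x] with y hy hyL
    refine H.phi_eq_zero_of_contract y (dualFrame_ne_zero hyL) ?_
    rw [H.contract_eq_zero_iff f ξ hy, funext (hvcoeff y hy)]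
    have : H.skewMatrix f ξ y * S y = 0 := by
      rw [hS, Matrix.mul_adjugate, hdet y hy, zero_smul]
    exact funext fun i => congrFun (congrFun this i) j
  have hQ : ∀ y ∈ f.dom, H.Q y (v y) (v y) =
      S y j j * ((H.gram f y).det * H.charCoeff (2 * n) y (ξ y)) := by
    intro y hy
    rw [← H.trace_adjugate_mul_gram f (Fintype.card_fin _) ξ hy]
    simp only [hv, map_sum, LinearMap.sum_apply, map_smul, LinearMap.smul_apply, smul_eq_mul,
      Matrix.trace, Matrix.diag_apply, Matrix.mul_apply, Finset.mul_sum]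
    refine Finset.sum_congr rfl fun i _ => Finset.sum_congr rfl fun k _ => ?_
    have h1 := hSS y hy j k i j
    rw [hsymm y hy j k] at h1
    change _ = S y j j * (S y i k * H.Q y (f.sec k y) (f.sec i y))
    linear_combination (H.Q y (f.sec k y) (f.sec i y)) * h1
  refine ⟨v, hvhol, fun h => hj ?_, ?_, fun hD => ?_, fun hD => ?_⟩
  · rw [← hvcoeff x f.self_mem j, h, map_zero]
  · filter_upwards [f.mem_dom, eventually_mem_baseSet (L := L) x, hvhol.eventually,
      eventually_eventually_nhds.2 hker, (hShol j j).continuousAt.eventually_ne hj]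
      with y hy hyL hvy hkery hjy
    refine le_antisymm ?_ ?_
    · rintro _ ⟨s, -, hs, rfl⟩
      have h0 : H.contract y (ξ y) (s y) = 0 := by
        simp [contract, hs.self_of_nhds]
      have h1 := mul_adjugate_eq_of_mulVec_eq_zero (hdet y hy)
        ((H.contract_eq_zero_iff f ξ hy _).1 h0)
      refine Submodule.mem_span_singleton.2 ⟨f.coeff j y (s y) / S y j j, ?_⟩
      rw [← f.sum_coeff hy (s y), hv, Finset.smul_sum]
      refine Finset.sum_congr rfl fun i _ => ?_
      rw [smul_smul]
      congr 1
      rw [f.sum_coeff hy (s y), div_mul_eq_mul_div, div_eq_iff hjy]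
      exact (h1 j i j).symm
    · rw [Submodule.span_singleton_le_iff_mem]
      exact ⟨v, hvy, hkery, rfl⟩
  · rw [hQ x f.self_mem]
    exact mul_ne_zero hj (mul_ne_zero (H.det_gram_ne_zero f f.self_mem) fun h => hD
      ((H.mem_D_iff (FiberBundle.mem_baseSet_trivializationAt' x)).2 h))
  · obtain ⟨g, hg, hgx, hgz⟩ := (H.charCoeff_hol (dualFrame_hol x) (2 * n)).exists_eq_localCoord_mul
      (hD _)
    refine ⟨fun y => S y j j * ((H.gram f y).det * g y),
      (hShol j j).mul ((HolFunAt.det (H.gram_hol f)).mul hg), ?_, ?_⟩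
    · refine mul_ne_zero hj (mul_ne_zero (H.det_gram_ne_zero f f.self_mem) ?_)
      rw [hgx]
      exact H.deriv_charCoeff_ne_zero hH hD
    · filter_upwards [f.mem_dom, hgz] with y hy hz
      rw [hQ y hy, hz]
      ring

end SOHiggsBundle

namespace SOHiggsBundle

/-! ### The map `ψ` on a fibre -/

variable (H : SOHiggsBundle L n V)

theorem Q_prStar (x : X) (a : Module.Dual ℂ (V x ⧸ H.V0 x)) (v : V x) :
    H.Q x (H.prStar x a) v = a ((H.V0 x).mkQ v) := by
  have : FiniteDimensional ℂ (V x) := finite_fiber (Fin (2 * n + 1) → ℂ) V x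
  exact LinearMap.BilinForm.apply_toDual_symm_apply (hB := H.Q_nondegenerate x) _ v

theorem eq_of_Q {x : X} {u w : V x} (h : ∀ v, H.Q x u v = H.Q x w v) : u = w := by
  have h1 := (H.Q_nondegenerate x).1 (u - w) fun v => by
    rw [map_sub, LinearMap.sub_apply, h, sub_self]
  exact sub_eq_zero.1 h1

theorem prStar_injective (x : X) : Function.Injective (H.prStar x) := by
  intro a b hab
  refine LinearMap.ext fun q => ?_
  obtain ⟨v, rfl⟩ := (H.V0 x).mkQ_surjective q
  rw [← H.Q_prStar, ← H.Q_prStar, hab]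

theorem psi_apply (x : X) (t : QuotDualSum H.V0 x) : H.psi x t = H.prStar x t.1 + t.2 := rfl

open scoped Classical in
/-- The linear form `Q(u, ·)` on `V / V_0` given by a vector `u` orthogonal to `V_0`; zero if `u`
is not orthogonal to `V_0`. -/
noncomputable def orthForm (x : X) (u : V x) : Module.Dual ℂ (V x ⧸ H.V0 x) :=
  if h : H.V0 x ≤ LinearMap.ker (H.Q x u) then (H.V0 x).liftQ (H.Q x u) h else 0

theorem orthForm_mkQ {x : X} {u : V x} (h : H.V0 x ≤ LinearMap.ker (H.Q x u)) (v : V x) :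
    H.orthForm x u ((H.V0 x).mkQ v) = H.Q x u v := by
  rw [orthForm, dif_pos h, Submodule.mkQ_apply, Submodule.liftQ_apply]

theorem prStar_orthForm {x : X} {u : V x} (h : H.V0 x ≤ LinearMap.ker (H.Q x u)) :
    H.prStar x (H.orthForm x u) = u :=
  H.eq_of_Q fun v => by rw [Q_prStar, orthForm_mkQ H h]

open scoped Classical in
/-- The vector of `(V / V_0)^* ⊕ V_0` given by a vector `u` orthogonal to `V_0` and a vector `b` of
`V_0`; a component whose vector does not satisfy its condition is zero. -/
noncomputable def mkSum (x : X) (u b : V x) : QuotDualSum H.V0 x :=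
  (H.orthForm x u, if h : b ∈ H.V0 x then ⟨b, h⟩ else 0)

theorem psi_mkSum {x : X} {u b : V x} (hu : H.V0 x ≤ LinearMap.ker (H.Q x u))
    (hb : b ∈ H.V0 x) : H.psi x (H.mkSum x u b) = u + b := by
  rw [psi_apply, mkSum, dif_pos hb, prStar_orthForm H hu]

theorem le_ker_Q {x : X} {v u : V x} (hv : H.V0 x = Submodule.span ℂ {v})
    (h : H.Q x u v = 0) : H.V0 x ≤ LinearMap.ker (H.Q x u) := by
  rw [hv, Submodule.span_singleton_le_iff_mem]
  exact h

theorem psi_bijective_of_Q_ne_zero {x : X} {v : V x} (hv : H.V0 x = Submodule.span ℂ {v})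
    (h : H.Q x v v ≠ 0) : Function.Bijective (H.psi x) := by
  have hmem : v ∈ H.V0 x := hv ▸ Submodule.mem_span_singleton_self v
  refine ⟨(injective_iff_map_eq_zero _).2 fun t ht => ?_, fun s => ?_⟩
  · obtain ⟨c, hc⟩ := Submodule.mem_span_singleton.1 (hv.le t.2.2)
    have h1 : H.Q x (H.psi x t) v = c * H.Q x v v := by
      rw [psi_apply, map_add, LinearMap.add_apply, Q_prStar, Submodule.mkQ_apply,
        (Submodule.Quotient.mk_eq_zero _).2 hmem, map_zero, zero_add, ← hc, map_smul,
        LinearMap.smul_apply, smul_eq_mul]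
    rw [ht, map_zero, LinearMap.zero_apply] at h1
    have hc0 : c = 0 := (mul_eq_zero.1 h1.symm).resolve_right h
    have h2 : t.2 = 0 := Subtype.ext (by rw [← hc, hc0, zero_smul]; rfl)
    rw [psi_apply, h2, Submodule.coe_zero, add_zero] at ht
    exact Prod.ext (H.prStar_injective x (ht.trans (map_zero _).symm)) h2
  · refine ⟨H.mkSum x (s - (H.Q x s v / H.Q x v v) • v) ((H.Q x s v / H.Q x v v) • v), ?_⟩
    rw [psi_mkSum H (H.le_ker_Q hv ?_) (Submodule.smul_mem _ _ hmem), sub_add_cancel]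
    rw [map_sub, LinearMap.sub_apply, map_smul, LinearMap.smul_apply, smul_eq_mul,
      div_mul_cancel₀ _ h, sub_self]

open scoped Classical in
/-- The inverse of `ψ_x`, or zero if `ψ_x` is not bijective. -/
noncomputable def psiInv (x : X) : V x →ₗ[ℂ] QuotDualSum H.V0 x :=
  if h : Function.Bijective (H.psi x) then (LinearEquiv.ofBijective (H.psi x) h).symm else 0

theorem psiInv_psi {x : X} (h : Function.Bijective (H.psi x)) (t : QuotDualSum H.V0 x) :
    H.psiInv x (H.psi x t) = t := by
  rw [psiInv, dif_pos h]
  exact (LinearEquiv.ofBijective (H.psi x) h).symm_apply_apply t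

theorem psi_psiInv {x : X} (h : Function.Bijective (H.psi x)) (v : V x) :
    H.psi x (H.psiInv x v) = v := by
  rw [psiInv, dif_pos h]
  exact (LinearEquiv.ofBijective (H.psi x) h).apply_symm_apply v

/-- If `V_0` is isotropic at `x`, its inclusion into `V_x` factors through `pr^*`. -/
theorem exists_lift_of_isotropic {x : X} (h : ∀ w ∈ H.V0 x, H.V0 x ≤ LinearMap.ker (H.Q x w)) :
    ∃ i : H.V0 x →ₗ[ℂ] Module.Dual ℂ (V x ⧸ H.V0 x), ∀ w : H.V0 x, H.prStar x (i w) = w := by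
  have hw : ∀ w : H.V0 x, H.prStar x (H.orthForm x w) = w := fun w =>
    H.prStar_orthForm (h w w.2)
  refine ⟨⟨⟨fun w => H.orthForm x w, fun a b => ?_⟩, fun c a => ?_⟩, hw⟩
  · exact H.prStar_injective x (by rw [map_add, hw, hw, hw]; rfl)
  · exact H.prStar_injective x (by rw [map_smul, hw, hw]; rfl)

/-! ### The map `ψ` on sections -/

theorem holSumAt_mkSum {x : X} {u b : ∀ y, V y} (hu : HolAt (Fin (2 * n + 1) → ℂ) u x)
    (hb : HolAt (Fin (2 * n + 1) → ℂ) b x)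
    (huo : ∀ᶠ y in 𝓝 x, H.V0 y ≤ LinearMap.ker (H.Q y (u y))) (hbm : ∀ᶠ y in 𝓝 x, b y ∈ H.V0 y) :
    HolSumAt (Fin (2 * n + 1) → ℂ) H.V0 (fun y => H.mkSum y (u y) (b y)) x := by
  refine ⟨fun s hs => (H.Q_hol x u s hu hs).congr ?_, hb.congr ?_⟩
  · filter_upwards [huo] with y hy
    exact H.orthForm_mkQ hy (s y)
  · filter_upwards [hbm] with y hy
    simp [mkSum, hy]

theorem holAt_psi [ContMDiffVectorBundle ω (Fin (2 * n + 1) → ℂ) V 𝓘(ℂ, ℂ)] {x : X}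
    {t : ∀ y, QuotDualSum H.V0 y} (ht : HolSumAt (Fin (2 * n + 1) → ℂ) H.V0 t x) :
    HolAt (Fin (2 * n + 1) → ℂ) (fun y => H.psi y (t y)) x := by
  refine HolAt.add (s := fun y => H.prStar y (t y).1) (H.holAt_of_Q fun s hs => ?_) ht.2
  simpa only [Q_prStar] using! ht.1 s hs

variable [IsManifold 𝓘(ℂ, ℂ) ω X] [ContMDiffVectorBundle ω (Fin (2 * n + 1) → ℂ) V 𝓘(ℂ, ℂ)]
  (hH : H.SmoothSpectralCurve)

include hH

theorem psi_bijective {x : X} (hx : x ∉ H.D) : Function.Bijective (H.psi x) := by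
  obtain ⟨v, -, -, hspan, hq, -⟩ := H.exists_spanning_section hH x
  exact H.psi_bijective_of_Q_ne_zero hspan.self_of_nhds (hq hx)

theorem isotropic {x : X} (hx : x ∈ H.D) :
    ∀ w ∈ H.V0 x, H.V0 x ≤ LinearMap.ker (H.Q x w) := by
  obtain ⟨v, -, -, hspan, -, hq⟩ := H.exists_spanning_section hH x
  obtain ⟨g, -, -, hg⟩ := hq hx
  have h0 : H.Q x (v x) (v x) = 0 := by
    rw [hg.self_of_nhds, localCoord_self, zero_mul]
  intro w hw
  refine H.le_ker_Q hspan.self_of_nhds ?_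
  obtain ⟨c, rfl⟩ := Submodule.mem_span_singleton.1 (hspan.self_of_nhds ▸ hw)
  rw [map_smul, LinearMap.smul_apply, h0, smul_zero]

/-- The set `D` is discrete and closed. -/
theorem eventually_notMem_D (x : X) : ∀ᶠ y in 𝓝[≠] x, y ∉ H.D := by
  obtain ⟨v, hv, -, hspan, hq0, hq⟩ := H.exists_spanning_section hH x
  have hne : ∀ᶠ y in 𝓝[≠] x, H.Q y (v y) (v y) ≠ 0 := by
    by_cases hx : x ∈ H.D
    · obtain ⟨g, hg, hgx, h⟩ := hq hx
      filter_upwards [eventually_localCoord_ne x, nhdsWithin_le_nhds h,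
        nhdsWithin_le_nhds (hg.continuousAt.eventually_ne hgx)] with y h1 h2 h3
      rw [h2]
      exact mul_ne_zero h1 h3
    · exact nhdsWithin_le_nhds ((H.Q_hol x v v hv hv).continuousAt.eventually_ne (hq0 hx))
  filter_upwards [hne, nhdsWithin_le_nhds hspan] with y h1 h2 hy
  have hmem : v y ∈ H.V0 y := h2 ▸ Submodule.mem_span_singleton_self (v y)
  exact h1 (H.isotropic hH hy _ hmem hmem)

/-- Off `D`, a holomorphic section of `V` is the image under `ψ` of a holomorphic section. -/
theorem exists_holSum_of_notMem {x : X} (hx : x ∉ H.D) {s : ∀ y, V y}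
    (hs : HolAt (Fin (2 * n + 1) → ℂ) s x) :
    ∃ t : ∀ y, QuotDualSum H.V0 y, HolSumAt (Fin (2 * n + 1) → ℂ) H.V0 t x ∧
      ∀ᶠ y in 𝓝 x, H.psi y (t y) = s y := by
  obtain ⟨v, hv, -, hspan, hq, -⟩ := H.exists_spanning_section hH x
  have hqh := H.Q_hol x v v hv hv
  -- the orthogonal projection of `s` to `V_0` is `c v`
  set c : X → ℂ := fun y => H.Q y (s y) (v y) / H.Q y (v y) (v y) with hc
  have hcv : HolAt (Fin (2 * n + 1) → ℂ) (fun y => c y • v y) x :=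
    HolAt.smul ((H.Q_hol x s v hs hv).div hqh (hq hx)) hv
  have horth : ∀ᶠ y in 𝓝 x, H.V0 y ≤ LinearMap.ker (H.Q y (s y - c y • v y)) := by
    filter_upwards [hspan, hqh.continuousAt.eventually_ne (hq hx)] with y h1 h2
    refine H.le_ker_Q h1 ?_
    rw [map_sub, LinearMap.sub_apply, map_smul, LinearMap.smul_apply, smul_eq_mul, hc,
      div_mul_cancel₀ _ h2, sub_self]
  have hmem : ∀ᶠ y in 𝓝 x, c y • v y ∈ H.V0 y := by
    filter_upwards [hspan] with y h1
    exact h1 ▸ Submodule.smul_mem _ _ (Submodule.mem_span_singleton_self _)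
  refine ⟨_, H.holSumAt_mkSum (hs.sub hcv) hcv horth hmem, ?_⟩
  filter_upwards [horth, hmem] with y h1 h2
  rw [H.psi_mkSum h1 h2, sub_add_cancel]

/-- At a point of `D`, the product of a holomorphic section of `V` with the local coordinate is the
image under `ψ` of a holomorphic section whose value at the point lies in `Γ_x`. -/
theorem exists_holSum_of_mem {x : X} (hx : x ∈ H.D)
    {i : H.V0 x →ₗ[ℂ] Module.Dual ℂ (V x ⧸ H.V0 x)} (hi : ∀ w : H.V0 x, H.prStar x (i w) = w)
    {s : ∀ y, V y} (hs : HolAt (Fin (2 * n + 1) → ℂ) s x) :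
    ∃ t : ∀ y, QuotDualSum H.V0 y, HolSumAt (Fin (2 * n + 1) → ℂ) H.V0 t x ∧
      (∀ᶠ y in 𝓝 x, H.psi y (t y) = localCoord x y • s y) ∧ t x ∈ Gam H.V0 x i := by
  obtain ⟨v, hv, -, hspan, -, hq⟩ := H.exists_spanning_section hH x
  obtain ⟨g, hg, hgx, hqg⟩ := hq hx
  -- as `Q(v, v) = z g`, the orthogonal projection of `z s` to `V_0` is `c v`
  set c : X → ℂ := fun y => H.Q y (s y) (v y) / g y with hc
  have hcv : HolAt (Fin (2 * n + 1) → ℂ) (fun y => c y • v y) x :=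
    HolAt.smul ((H.Q_hol x s v hs hv).div hg hgx) hv
  have horth : ∀ᶠ y in 𝓝 x,
      H.V0 y ≤ LinearMap.ker (H.Q y (localCoord x y • s y - c y • v y)) := by
    filter_upwards [hspan, hqg, hg.continuousAt.eventually_ne hgx] with y h1 h2 h3
    refine H.le_ker_Q h1 ?_
    rw [map_sub, LinearMap.sub_apply, map_smul, map_smul, LinearMap.smul_apply,
      LinearMap.smul_apply, h2, smul_eq_mul, smul_eq_mul, hc]
    field_simp
    ring
  have hmem : ∀ᶠ y in 𝓝 x, c y • v y ∈ H.V0 y := by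
    filter_upwards [hspan] with y h1
    exact h1 ▸ Submodule.smul_mem _ _ (Submodule.mem_span_singleton_self _)
  refine ⟨_, H.holSumAt_mkSum ((HolAt.smul (holFunAt_localCoord x) hs).sub hcv) hcv horth hmem,
    ?_, ⟨c x • v x, hmem.self_of_nhds⟩, ?_⟩
  · filter_upwards [horth, hmem] with y h1 h2
    rw [H.psi_mkSum h1 h2, sub_add_cancel]
  · refine Prod.ext (H.prStar_injective x ?_) ?_
    · simp only [mkSum]
      rw [H.prStar_orthForm horth.self_of_nhds, map_neg, hi, localCoord_self, zero_smul, zero_sub]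
    · simp only [mkSum]
      rw [dif_pos hmem.self_of_nhds]

omit hH in
/-- The image under `ψ` of a section with a simple pole and residue in `Γ_x` extends
holomorphically, because `ψ_x` vanishes on `Γ_x`. -/
theorem exists_holAt_of_simplePole {x : X}
    {i : H.V0 x →ₗ[ℂ] Module.Dual ℂ (V x ⧸ H.V0 x)} (hi : ∀ w : H.V0 x, H.prStar x (i w) = w)
    {t : ∀ y, QuotDualSum H.V0 y} {r : QuotDualSum H.V0 x} (hr : r ∈ Gam H.V0 x i)
    (ht : HasSimplePoleResidue (Fin (2 * n + 1) → ℂ) H.V0 t x r) :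
    ∃ s : ∀ y, V y, HolAt (Fin (2 * n + 1) → ℂ) s x ∧ ∀ᶠ y in 𝓝[≠] x, H.psi y (t y) = s y := by
  obtain ⟨t', ht', hz, hx⟩ := ht
  obtain ⟨w, rfl⟩ := hr
  have h0 : H.psi x (t' x) = 0 := by
    rw [hx, psi_apply, map_neg, hi, neg_add_cancel]
  obtain ⟨s, hs, h⟩ := (H.holAt_psi ht').exists_eq_localCoord_smul h0
  refine ⟨s, hs, ?_⟩
  filter_upwards [hz, nhdsWithin_le_nhds h, eventually_localCoord_ne x] with y h1 h2 h3
  rw [← h1, map_smul] at h2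
  exact smul_right_injective _ h3 h2

end SOHiggsBundle

namespace SOHiggsBundle

/-! ### The embedding of sheaves -/

variable [IsManifold 𝓘(ℂ, ℂ) ω X]
  [ContMDiffVectorBundle ω (Fin (2 * n + 1) → ℂ) V 𝓘(ℂ, ℂ)]
  (H : SOHiggsBundle L n V)

/-- The family `ψ⁻¹ s`, with junk values at the points of `D`. -/
noncomputable def thetaFam {U : Opens X} (s : ∀ x : U, V x) : ∀ x : U, QuotDualSum H.V0 x :=
  fun x => H.psiInv x (s x)

theorem extZero_thetaFam {U : Opens X} (s : ∀ x : U, V x) {y : X} (hy : y ∈ U) :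
    extZero (H.thetaFam s) y = H.psiInv y (extZero s y) := by
  rw [extZero_of_mem _ hy, extZero_of_mem _ hy]
  rfl

section Smooth

variable (hH : H.SmoothSpectralCurve)

include hH

theorem exists_lift {x : X} (hx : x ∈ H.D) :
    ∃ i : H.V0 x →ₗ[ℂ] Module.Dual ℂ (V x ⧸ H.V0 x), ∀ w : H.V0 x, H.prStar x (i w) = w :=
  H.exists_lift_of_isotropic (H.isotropic hH hx)

theorem extendsHolAt_thetaFam {U : Opens X} (s : holSec (Fin (2 * n + 1) → ℂ) V U) (x : U)
    (hx : (x : X) ∉ H.D) :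
    ExtendsHolAt (Fin (2 * n + 1) → ℂ) H.V0 (extZero (H.thetaFam s.1)) x := by
  obtain ⟨t, ht, h⟩ := H.exists_holSum_of_notMem hH hx (s.2 x)
  refine ⟨t, ht, ?_⟩
  filter_upwards [nhdsWithin_le_nhds h, eventually_mem' x, H.eventually_notMem_D hH x]
    with y h1 h2 h3
  rw [H.extZero_thetaFam _ h2, ← h1, H.psiInv_psi (H.psi_bijective hH h3)]

theorem hasSimplePoleResidue_thetaFam {U : Opens X} (s : holSec (Fin (2 * n + 1) → ℂ) V U) (x : U)
    (hx : (x : X) ∈ H.D) {i : H.V0 x →ₗ[ℂ] Module.Dual ℂ (V x ⧸ H.V0 x)}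
    (hi : ∀ w : H.V0 x, H.prStar x (i w) = w) :
    ∃ r ∈ Gam H.V0 (x : X) i,
      HasSimplePoleResidue (Fin (2 * n + 1) → ℂ) H.V0 (extZero (H.thetaFam s.1)) x r := by
  obtain ⟨t, ht, h, hr⟩ := H.exists_holSum_of_mem hH hx hi (s.2 x)
  refine ⟨_, hr, t, ht, ?_, rfl⟩
  filter_upwards [nhdsWithin_le_nhds h, eventually_mem' x, H.eventually_notMem_D hH x]
    with y h1 h2 h3
  rw [H.extZero_thetaFam _ h2, ← map_smul, ← h1, H.psiInv_psi (H.psi_bijective hH h3)]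

/-- The family `ψ⁻¹ s` of meromorphic sections attached to a holomorphic section `s`. -/
noncomputable def thetaSec (U : Opens X) :
    holSec (Fin (2 * n + 1) → ℂ) V U →ₗ[holFun U] merSec (Fin (2 * n + 1) → ℂ) H.V0 U where
  toFun s := ⟨H.thetaFam s.1, fun x => by
    by_cases hx : (x : X) ∈ H.D
    · obtain ⟨i, hi⟩ := H.exists_lift hH hx
      obtain ⟨-, -, t, ht, h, -⟩ := H.hasSimplePoleResidue_thetaFam hH s x hx hi
      exact ⟨localCoord x, t, holFunAt_localCoord _, eventually_localCoord_ne _, ht, h⟩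
    · obtain ⟨t, ht, h⟩ := H.extendsHolAt_thetaFam hH s x hx
      exact ⟨fun _ => 1, t, HolFunAt.const 1 _, by simp, ht, by simpa using h⟩⟩
  map_add' s t := Subtype.ext (funext fun x => map_add (H.psiInv x) (s.1 x) (t.1 x))
  map_smul' c s := Subtype.ext (funext fun x => map_smul (H.psiInv x) (c.1 x) (s.1 x))

/-- The morphism `𝒪_X(V) → ℳ_X(V_1^* ⊕ V_0)` induced by `ψ⁻¹`. -/
noncomputable def theta (U : Opens X) :
    holSec (Fin (2 * n + 1) → ℂ) V U →ₗ[holFun U] Mer (Fin (2 * n + 1) → ℂ) H.V0 U :=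
  (toMer (Fin (2 * n + 1) → ℂ) H.V0 U).comp (H.thetaSec hH U)

omit hH in
theorem toMer_eq_iff {U : Opens X} {t t' : merSec (Fin (2 * n + 1) → ℂ) H.V0 U} :
    toMer (Fin (2 * n + 1) → ℂ) H.V0 U t = toMer (Fin (2 * n + 1) → ℂ) H.V0 U t' ↔
      ∀ x : U, ∀ᶠ y in 𝓝[≠] (x : X), extZero t.1 y = extZero t'.1 y := by
  rw [toMer, Submodule.mkQ_apply, Submodule.mkQ_apply, Submodule.Quotient.eq]
  have h : ∀ y ∈ U, extZero (t - t').1 y = 0 ↔ extZero t.1 y = extZero t'.1 y := by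
    intro y hy
    rw [extZero_of_mem _ hy, extZero_of_mem _ hy, extZero_of_mem _ hy]
    exact sub_eq_zero
  refine forall_congr' fun x => eventually_congr ?_
  filter_upwards [eventually_mem' x] with y hy using h y hy

/-- A family of meromorphic sections represents `Θ(s)` if and only if `ψ` maps it to `s`. -/
theorem toMer_eq_theta_iff {U : Opens X} (s : holSec (Fin (2 * n + 1) → ℂ) V U)
    (t : merSec (Fin (2 * n + 1) → ℂ) H.V0 U) :
    toMer (Fin (2 * n + 1) → ℂ) H.V0 U t = H.theta hH U s ↔
      ∀ x : U, ∀ᶠ y in 𝓝[≠] (x : X), H.psi y (extZero t.1 y) = extZero s.1 y := by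
  refine (H.toMer_eq_iff (t' := H.thetaSec hH U s)).trans
    (forall_congr' fun x => eventually_congr ?_)
  filter_upwards [eventually_mem' x, H.eventually_notMem_D hH x] with y hy hD
  have hb := H.psi_bijective hH hD
  have : extZero (H.thetaSec hH U s).1 y = H.psiInv y (extZero s.1 y) := H.extZero_thetaFam _ hy
  rw [this]
  exact ⟨fun h => by rw [h, H.psi_psiInv hb], fun h => by rw [← h, H.psiInv_psi hb]⟩

theorem theta_injective (U : Opens X) : Function.Injective (H.theta hH U) := by
  intro s s' h
  have h1 := (H.toMer_eq_theta_iff hH s' (H.thetaSec hH U s)).1 h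
  have h2 := (H.toMer_eq_theta_iff hH s (H.thetaSec hH U s)).1 rfl
  refine Subtype.ext (funext fun x => ?_)
  have := HolAt.eq_of_eventually (s.2 x) (s'.2 x)
    ((h1 x).mp ((h2 x).mono fun y ha hb => ha.symm.trans hb))
  rwa [extZero_of_mem _ x.2, extZero_of_mem _ x.2] at this

theorem range_theta [T1Space X] {i : ∀ x, H.V0 x →ₗ[ℂ] Module.Dual ℂ (V x ⧸ H.V0 x)}
    (hi : ∀ x ∈ H.D, ∀ w : H.V0 x, H.prStar x (i x w) = w) (U : Opens X) :
    Set.range (H.theta hH U) = heckeSec (Fin (2 * n + 1) → ℂ) H.V0 H.D i U := by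
  refine Set.Subset.antisymm ?_ ?_
  · rintro _ ⟨s, rfl⟩
    exact ⟨H.thetaSec hH U s, rfl, H.extendsHolAt_thetaFam hH s,
      fun x hx => H.hasSimplePoleResidue_thetaFam hH s x hx (hi x hx)⟩
  · rintro _ ⟨t, rfl, hoff, hon⟩
    have hloc : ∀ x : U, ∃ s : ∀ y, V y, HolAt (Fin (2 * n + 1) → ℂ) s x ∧
        ∀ᶠ y in 𝓝[≠] (x : X), H.psi y (extZero t.1 y) = s y := by
      intro x
      by_cases hx : (x : X) ∈ H.D
      · obtain ⟨r, hr, hres⟩ := hon x hx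
        exact H.exists_holAt_of_simplePole (hi x hx) hr hres
      · obtain ⟨t', ht', h⟩ := hoff x hx
        exact ⟨_, H.holAt_psi ht', h.mono fun y hy => by rw [hy]⟩
    obtain ⟨s, hs⟩ := exists_holSec_of_local hloc
    exact ⟨s, ((H.toMer_eq_theta_iff hH s t).2 hs).symm⟩

end Smooth

end SOHiggsBundle

end Higgs

end HiggsHecke

theorem mainTheorem3 {X : Type*} [TopologicalSpace X] [T2Space X] [ConnectedSpace X]
    [ChartedSpace ℂ X] [IsManifold 𝓘(ℂ, ℂ) ω X]
    (L : X → Type*) [TopologicalSpace (TotalSpace ℂ L)]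
    [∀ x, AddCommGroup (L x)] [∀ x, Module ℂ (L x)] [∀ x, TopologicalSpace (L x)]
    [FiberBundle ℂ L] [VectorBundle ℂ ℂ L] [ContMDiffVectorBundle ω ℂ L 𝓘(ℂ, ℂ)]
    (n : ℕ)
    (V : X → Type*) [TopologicalSpace (TotalSpace (Fin (2 * n + 1) → ℂ) V)]
    [∀ x, AddCommGroup (V x)] [∀ x, Module ℂ (V x)] [∀ x, TopologicalSpace (V x)]
    [FiberBundle (Fin (2 * n + 1) → ℂ) V] [VectorBundle ℂ (Fin (2 * n + 1) → ℂ) V]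
    [ContMDiffVectorBundle ω (Fin (2 * n + 1) → ℂ) V 𝓘(ℂ, ℂ)]
    (H : SOHiggsBundle L n V) (hH : H.SmoothSpectralCurve) :
    -- `V_0` is a holomorphic line subbundle of `V`
    IsHolLineSubbundle (Fin (2 * n + 1) → ℂ) H.V0 ∧
    -- `ψ : V_1^* ⊕ V_0 → V` is an isomorphism away from `D`
    (∀ x, x ∉ H.D → Function.Bijective (H.psi x)) ∧
    ∃ i : ∀ x, H.V0 x →ₗ[ℂ] Module.Dual ℂ (V x ⧸ H.V0 x),
      -- for `x ∈ D` the map `i_x` is injective, and `pr^* ∘ i_x` is the inclusion of `(V_0)_x`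
      (∀ x ∈ H.D, Function.Injective (i x) ∧ ∀ w : H.V0 x, H.prStar x (i x w) = w) ∧
      -- the embedding of sheaves of `𝒪_X`-modules `𝒪_X(V) → ℳ_X(V_1^* ⊕ V_0)`
      ∃ Θ : ∀ U : Opens X, holSec (Fin (2 * n + 1) → ℂ) V U →ₗ[holFun U]
          Mer (Fin (2 * n + 1) → ℂ) H.V0 U,
        (∀ (U U' : Opens X) (h : U' ≤ U) (s : holSec (Fin (2 * n + 1) → ℂ) V U),
          Θ U' (resHol h s) = resMer (Fin (2 * n + 1) → ℂ) H.V0 h (Θ U s)) ∧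
        (∀ U : Opens X, Function.Injective (Θ U)) ∧
        -- it is induced by `ψ⁻¹`
        (∀ (U : Opens X) (s : holSec (Fin (2 * n + 1) → ℂ) V U)
          (t : merSec (Fin (2 * n + 1) → ℂ) H.V0 U),
          toMer (Fin (2 * n + 1) → ℂ) H.V0 U t = Θ U s →
            ∀ x : U, ∀ᶠ y in 𝓝[≠] (x : X), H.psi y (extZero t.1 y) = extZero s.1 y) ∧
        -- its image consists of the sections with at most simple poles along `D` and residues
        -- in `Γ_x = {(-i_x w, w)}`
        (∀ U : Opens X, Set.range (Θ U) = heckeSec (Fin (2 * n + 1) → ℂ) H.V0 H.D i U) := by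
  classical
  refine ⟨fun x => ?_, fun x hx => H.psi_bijective hH hx, ?_⟩
  · obtain ⟨v, hv, hv0, hspan, -⟩ := H.exists_spanning_section hH x
    exact ⟨v, hv, hv0, hspan⟩
  have hi : ∀ x, ∃ i : H.V0 x →ₗ[ℂ] Module.Dual ℂ (V x ⧸ H.V0 x),
      x ∈ H.D → ∀ w : H.V0 x, H.prStar x (i w) = w := fun x => by
    by_cases hx : x ∈ H.D
    · exact (H.exists_lift hH hx).imp fun _ h _ => h
    · exact ⟨0, fun h => absurd h hx⟩
  choose i hi using hi
  refine ⟨i, fun x hx => ⟨fun a b hab => Subtype.ext ?_, hi x hx⟩, H.theta hH,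
    fun _ _ _ _ => rfl, H.theta_injective hH, fun U s t => (H.toMer_eq_theta_iff hH s t).1,
    H.range_theta hH hi⟩
  rw [← hi x hx a, ← hi x hx b, hab]
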